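/- **Theorem (Auslander–Bridger formula for restricted G-dimension).** Let $R$ be a quasi-local ring (a commutative ring with identity having a unique maximal ideal $m$; $R$ need be neither Noetherian nor coherent), and let $M$ be a nonzero $R$-module of finite restricted G-dimension. Then $$\operatorname{depth} M+\widetilde{\mathrm G}\mathrm{dim}_R M=\operatorname{depth} R$$ as an equality in $\{0,1,2,\dots\}\cup\{\infty\}$; in particular $\operatorname{depth} M=\infty$ if and only if $\operatorname{depth} R=\infty$. Here the terms are as follows. * For an ideal $I$ of a commutative ring $A$ and an $A$-module $N$, $\operatorname{Depth}_I N$ is the supremum of the lengths of regular sequences on $N$ contained in $I$. For an $R$-module $N$ with $mN\neq N$, $\operatorname{depth} N$ is the supremum of $\operatorname{Depth}_{mS}(N\otimes_R S)$ over all faithfully flat (commutative) $R$-algebras $S$. * An $R$-module $N$ is $(FP)_\infty$ if for every $n\ge 0$ there is an exact sequence $F_n\to\cdots\to F_1\to F_0\to N\to 0$ with all $F_i$ finitely generated free $R$-modules. Write $N^*=\operatorname{Hom}_R(N,R)$. * The restricted G-class $\widetilde{\mathrm G}(R)$ consists of the finitely generated $R$-modules $G$ such that $\operatorname{Ext}^i_R(G,R)=0=\operatorname{Ext}^i_R(G^*,R)$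 for all $i>0$, the natural map $G\to G^{**}$ is an isomorphism, and both $G$ and $G^*$ are $(FP)_\infty$. * A $\widetilde{\mathrm G}$-resolution of $M$ is an exact sequence $\cdots\to G_1\to G_0\to M\to 0$ with every $G_i$ in $\widetilde{\mathrm G}(R)$; its length is the supremum of the $i$ with $G_i\neq 0$ (and $0$ if all $G_i$ are zero). The restricted G-dimension $\widetilde{\mathrm G}\mathrm{dim}_R M$ is the infimum of the lengths of all $\widetilde{\mathrm G}$-resolutions of $M$; it is finite when $M$ has such a resolution of finite length. -/

import Mathlib

open scoped TensorProduct

universe u v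

/-- `M` is `(FP)_n` over `R`: there is an exact sequence `F_n → ⋯ → F_1 → F_0 → M → 0` in which
`F_i = R ^ (k i)` is a finitely generated free module for `0 ≤ i ≤ n`. Exactness is imposed at `M`,
at `F_0` if `1 ≤ n`, and at `F_{i+1}` if `i + 2 ≤ n`; the data in degrees above `n` are arbitrary
(they may be taken to be zero). -/
def IsFPn (R : Type u) [CommRing R] (M : Type v) [AddCommGroup M] [Module R M] (n : ℕ) : Prop :=
  ∃ (k : ℕ → ℕ) (d : ∀ i, (Fin (k (i + 1)) → R) →ₗ[R] (Fin (k i) → R))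
    (ε : (Fin (k 0) → R) →ₗ[R] M),
    Function.Surjective ε ∧
    (1 ≤ n → Function.Exact (d 0) ε) ∧
    ∀ i, i + 2 ≤ n → Function.Exact (d (i + 1)) (d i)

/-- `M` is `(FP)_∞`: it is `(FP)_n` for every `n`. -/
def IsFPInfinity (R : Type u) [CommRing R] (M : Type v) [AddCommGroup M] [Module R M] : Prop :=
  ∀ n, IsFPn R M n

/-- `Ext^i_R(M, R) = 0` for all `i > 0`. -/
def ExtToRingVanishes (R : Type u) [CommRing R] (M : Type u) [AddCommGroup M] [Module R M] :
    Prop :=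
  ∀ i : ℕ, 0 < i →
    Subsingleton (CategoryTheory.Abelian.Ext (ModuleCat.of R M) (ModuleCat.of R R) i)

/-- The G-class `G(R)`. -/
structure IsGClass (R : Type u) [CommRing R] (M : Type u) [AddCommGroup M] [Module R M] :
    Prop where
  finite : Module.Finite R M
  ext_self : ExtToRingVanishes R M
  ext_dual : ExtToRingVanishes R (Module.Dual R M)
  reflexive : Function.Bijective (Module.Dual.eval R M)

/-- The restricted G-class `G̃(R)`. -/
structure IsRestrictedGClass (R : Type u) [CommRing R] (M : Type u) [AddCommGroup M]
    [Module R M] : Prop where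
  gClass : IsGClass R M
  fpInfinity : IsFPInfinity R M
  fpInfinity_dual : IsFPInfinity R (Module.Dual R M)

/-- A `G̃`-resolution `⋯ → G_1 → G_0 → M → 0` of `M`: an exact sequence in which all `G_i` belong
to the restricted G-class. As these are finitely generated, it is no restriction to take the `G_i` in
the universe of `R`, whatever the universe of `M`. -/
structure RestrictedGResolution (R : Type u) [CommRing R] (M : Type v) [AddCommGroup M]
    [Module R M] where
  G : ℕ → ModuleCat.{u} R
  d : ∀ i, G (i + 1) →ₗ[R] G i
  ε : G 0 →ₗ[R] M
  mem : ∀ i, IsRestrictedGClass R (G i)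
  surjective : Function.Surjective ε
  exact_zero : Function.Exact (d 0) ε
  exact_succ : ∀ i, Function.Exact (d (i + 1)) (d i)

/-- The length of a resolution: the supremum of the `i` with `G_i ≠ 0` (it is `0` for the zero
complex, and `⊤` if infinitely many `G_i` are nonzero). -/
noncomputable def RestrictedGResolution.length {R : Type u} [CommRing R] {M : Type v}
    [AddCommGroup M] [Module R M] (G : RestrictedGResolution R M) : ℕ∞ :=
  ⨆ (i : ℕ) (_ : Nontrivial (G.G i)), (i : ℕ∞)

/-- The restricted G-dimension: the infimum of the lengths of all `G̃`-resolutions. It is `⊤` if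
there is no `G̃`-resolution of finite length, in particular if there is none at all. -/
noncomputable def restrictedGDim (R : Type u) [CommRing R] (M : Type v) [AddCommGroup M]
    [Module R M] : ℕ∞ :=
  ⨅ G : RestrictedGResolution R M, G.length

/-- The classical depth of `M` with respect to `I`: the supremum of the lengths of the regular
sequences on `M` contained in `I`. -/
noncomputable def classicalDepth {R : Type u} [CommRing R] (I : Ideal R) (M : Type v)
    [AddCommGroup M] [Module R M] : ℕ∞ :=
  ⨆ (rs : List R) (_ : ∀ r ∈ rs, r ∈ I) (_ : RingTheory.Sequence.IsRegular M rs),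
    (rs.length : ℕ∞)

/-- The (Hochster–Barger–Northcott) depth of `M` with respect to `I`: the supremum of the classical
depths of `M ⊗_R S` with respect to `IS`, over all faithfully flat `R`-algebras `S`. -/
noncomputable def idealDepth {R : Type u} [CommRing R] (I : Ideal R) (M : Type v)
    [AddCommGroup M] [Module R M] : ℕ∞ :=
  ⨆ (S : Type u) (_ : CommRing S) (_ : Algebra R S) (_ : Module.FaithfullyFlat R S),
    classicalDepth (I.map (algebraMap R S)) (S ⊗[R] M)

/-- The depth of a module over a quasi-local ring: its depth with respect to the maximal ideal. -/
noncomputable def localDepth (R : Type u) [CommRing R] [IsLocalRing R] (M : Type v)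
    [AddCommGroup M] [Module R M] : ℕ∞ :=
  idealDepth (IsLocalRing.maximalIdeal R) M

/-! ### Ext groups: functoriality and long exact sequences -/

section

open CategoryTheory Abelian

/-! Depth is made cohomological. For a finite subset x of the maximal ideal, let A be the subring of
R generated by x, J the ideal xA, and H^i_x(N) = Ext^i_A(A/J, N). As A is Noetherian, H_x behaves
like Koszul cohomology although R is arbitrary: it has long exact sequences, x kills it, and it
vanishes below degree k exactly when some faithfully flat S carries a weakly regular sequence of
length k on S ⊗ N inside xS (`FinsetExtVanishes.exists_isWeaklyRegular`,
`finsetExtVanishes_of_isWeaklyRegular`). For N nonzero and finitely generated, depth N ≥ k then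
means that H^i_x(N) = 0 for i < k and some x, hence for every larger x
(`natCast_le_localDepth_iff`).

A module G in the restricted class embeds in P* for any finite free P covering G*, and the cokernel
is the dual of the kernel of P → G*, again in the class. So H_x(G) vanishes in the initial range
where H_x(R) does, and in the next degree k the map H^k_x(G) → H^k_x(P*) is still injective.

The crux is `exists_map_eq_zero_of_not_surjective_dualMap`: if K → G is not surjective on duals, it
is not injective on the first nonvanishing H^k_x once x is large. This replaces minimality of
resolutions: a matrix with entries in x acts as zero on cohomology. Applied to M → 0 with M nonzero
in the class, it gives depth M = depth R. Applied to 0 → K → G → M → 0 with M of G-dimension 1, it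
gives depth M + 1 = depth R. Higher dimensions follow by induction on syzygies and the long exact
sequence (`depthGE_iff_of_hasGDimLE`). -/

/-- `Ext` groups of modules over `A`, for unbundled modules. -/
abbrev ExtGroup (A : Type u) [CommRing A] (N M : Type u) [AddCommGroup N] [Module A N]
    [AddCommGroup M] [Module A M] (i : ℕ) : Type u :=
  Ext (ModuleCat.of A N) (ModuleCat.of A M) i

namespace ExtGroup

variable {A : Type u} [CommRing A] {N N₁ N₂ N₃ M M₁ M₂ M₃ : Type u}
  [AddCommGroup N] [Module A N] [AddCommGroup N₁] [Module A N₁] [AddCommGroup N₂] [Module A N₂]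
  [AddCommGroup N₃] [Module A N₃]
  [AddCommGroup M] [Module A M] [AddCommGroup M₁] [Module A M₁] [AddCommGroup M₂] [Module A M₂]
  [AddCommGroup M₃] [Module A M₃]

/-- Functoriality of `Ext` in the second variable. -/
noncomputable def map (N : Type u) [AddCommGroup N] [Module A N] (f : M₁ →ₗ[A] M₂) (i : ℕ) :
    ExtGroup A N M₁ i →+ ExtGroup A N M₂ i :=
  (Ext.mk₀ (ModuleCat.ofHom f)).postcomp (ModuleCat.of A N) (add_zero i)

lemma map_apply (f : M₁ →ₗ[A] M₂) {i : ℕ} (e : ExtGroup A N M₁ i) :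
    map N f i e = e.comp (Ext.mk₀ (ModuleCat.ofHom f)) (add_zero i) := rfl

lemma map_id {i : ℕ} (e : ExtGroup A N M i) : map N LinearMap.id i e = e := by
  rw [map_apply, ModuleCat.ofHom_id, Ext.comp_mk₀_id]

lemma map_comp (f : M₁ →ₗ[A] M₂) (g : M₂ →ₗ[A] M₃) {i : ℕ} (e : ExtGroup A N M₁ i) :
    map N (g ∘ₗ f) i e = map N g i (map N f i e) := by
  simp [map_apply, ModuleCat.ofHom_comp]

lemma map_add (f g : M₁ →ₗ[A] M₂) {i : ℕ} (e : ExtGroup A N M₁ i) :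
    map N (f + g) i e = map N f i e + map N g i e := by
  simp only [map_apply, ModuleCat.ofHom_add, Ext.mk₀_add, Ext.comp_add]

lemma map_zero {i : ℕ} (e : ExtGroup A N M₁ i) : map N (0 : M₁ →ₗ[A] M₂) i e = 0 := by
  simp only [map_apply, ModuleCat.ofHom_zero, Ext.mk₀_zero, Ext.comp_zero]

/-- The scalar can be moved from the second variable to the first, where it is zero. -/
lemma map_smul_eq_zero (f : M₁ →ₗ[A] M₂) {a : A} (ha : a ∈ Module.annihilator A N) {i : ℕ}
    (e : ExtGroup A N M₁ i) : map N (a • f) i e = 0 := by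
  have h0 : a • 𝟙 (ModuleCat.of A N) = 0 := by
    ext x
    exact Module.mem_annihilator.mp ha x
  have h1 : a • e = 0 := by
    have : a • e = (Ext.mk₀ (a • 𝟙 (ModuleCat.of A N))).comp e (zero_add i) := by
      simp [Ext.mk₀_smul]
    rw [this, h0, Ext.mk₀_zero, Ext.zero_comp]
  have h2 : ModuleCat.ofHom (a • f) = a • ModuleCat.ofHom f := rfl
  rw [map_apply, h2, Ext.mk₀_smul, Ext.comp_smul, ← Ext.smul_comp, h1, Ext.zero_comp]

lemma subsingleton_of_leftInverse (f : M₁ →ₗ[A] M₂) (g : M₂ →ₗ[A] M₁)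
    (h : Function.LeftInverse g f) {i : ℕ} (h₂ : Subsingleton (ExtGroup A N M₂ i)) :
    Subsingleton (ExtGroup A N M₁ i) := by
  refine ⟨fun a b ↦ ?_⟩
  have hid : g ∘ₗ f = LinearMap.id := LinearMap.ext h
  rw [← map_id a, ← map_id b, ← hid, map_comp, map_comp, Subsingleton.elim (map N f i a)]

lemma subsingleton_congr_right (e : M₁ ≃ₗ[A] M₂) {i : ℕ} :
    Subsingleton (ExtGroup A N M₁ i) ↔ Subsingleton (ExtGroup A N M₂ i) :=
  ⟨subsingleton_of_leftInverse e.symm.toLinearMap e.toLinearMap e.right_inv,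
    subsingleton_of_leftInverse e.toLinearMap e.symm.toLinearMap e.left_inv⟩

lemma subsingleton_congr_left (e : N₁ ≃ₗ[A] N₂) {i : ℕ} :
    Subsingleton (ExtGroup A N₁ M i) ↔ Subsingleton (ExtGroup A N₂ M i) := by
  have key : ∀ {N₁ N₂ : Type u} [AddCommGroup N₁] [Module A N₁] [AddCommGroup N₂] [Module A N₂]
      (e : N₁ ≃ₗ[A] N₂), Subsingleton (ExtGroup A N₁ M i) → Subsingleton (ExtGroup A N₂ M i) := by
    intro N₁ N₂ _ _ _ _ e h
    refine ⟨fun a b ↦ ?_⟩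
    have hid : ModuleCat.ofHom e.symm.toLinearMap ≫ ModuleCat.ofHom e.toLinearMap =
        𝟙 (ModuleCat.of A N₂) := by
      ext x
      exact e.apply_symm_apply x
    have h' : ∀ a : ExtGroup A N₂ M i, (Ext.mk₀ (ModuleCat.ofHom e.symm.toLinearMap)).comp
        ((Ext.mk₀ (ModuleCat.ofHom e.toLinearMap)).comp a (zero_add i)) (zero_add i) = a := by
      intro a
      rw [Ext.mk₀_comp_mk₀_assoc, hid, Ext.mk₀_id_comp]
    rw [← h' a, ← h' b]
    congr 1
    exact Subsingleton.elim _ _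
  exact ⟨key e, key e.symm⟩

lemma subsingleton_zero_iff :
    Subsingleton (ExtGroup A N M 0) ↔ ∀ f : N →ₗ[A] M, f = 0 := by
  rw [Ext.addEquiv₀.toEquiv.subsingleton_congr,
    ModuleCat.homAddEquiv.toEquiv.subsingleton_congr]
  exact ⟨fun h f ↦ Subsingleton.elim _ _, fun h ↦ ⟨fun f g ↦ (h f).trans (h g).symm⟩⟩

lemma subsingleton_of_projective [Module.Projective A N] (M : Type u) [AddCommGroup M]
    [Module A M] (i : ℕ) : Subsingleton (ExtGroup A N M (i + 1)) := by
  have : Projective (ModuleCat.of A N) := (IsProjective.iff_projective N).mp inferInstance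
  exact Ext.subsingleton_of_projective _ _ _

lemma shortExact_of {f : M₁ →ₗ[A] M₂} {g : M₂ →ₗ[A] M₃} (hf : Function.Injective f)
    (hfg : Function.Exact f g) (hg : Function.Surjective g) :
    (ShortComplex.mk (ModuleCat.ofHom f) (ModuleCat.ofHom g)
      (by ext x; exact hfg.apply_apply_eq_zero x)).ShortExact where
  exact := (ShortComplex.ShortExact.moduleCat_exact_iff_function_exact _).mpr hfg
  mono_f := (ModuleCat.mono_iff_injective _).mpr hf
  epi_g := (ModuleCat.epi_iff_surjective _).mpr hg

section Covariant

variable {f : M₁ →ₗ[A] M₂} {g : M₂ →ₗ[A] M₃} (hf : Function.Injective f)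
    (hfg : Function.Exact f g) (hg : Function.Surjective g)

include hf hfg hg

lemma exists_map_eq {i : ℕ} (e : ExtGroup A N M₂ i) (he : map N g i e = 0) :
    ∃ e', map N f i e' = e :=
  Ext.covariant_sequence_exact₂ (ModuleCat.of A N) (shortExact_of hf hfg hg) e he

lemma map_injective {i : ℕ} (h : ∀ j, j + 1 = i → Subsingleton (ExtGroup A N M₃ j)) :
    Function.Injective (map N f i) := by
  cases i with
  | zero =>
    have : Mono (ModuleCat.ofHom f) := (ModuleCat.mono_iff_injective _).mpr hf
    exact Ext.postcomp_mk₀_injective_of_mono (ModuleCat.of A N) (ModuleCat.ofHom f)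
  | succ i =>
    rw [injective_iff_map_eq_zero]
    intro e he
    obtain ⟨x, rfl⟩ := Ext.covariant_sequence_exact₁ (ModuleCat.of A N)
      (shortExact_of hf hfg hg) e he rfl
    have := h i rfl
    rw [Subsingleton.elim (α := ExtGroup A N M₃ i) x 0, Ext.zero_comp]

lemma subsingleton_fst {i : ℕ} (h : ∀ j, j + 1 = i → Subsingleton (ExtGroup A N M₃ j))
    (h₂ : Subsingleton (ExtGroup A N M₂ i)) : Subsingleton (ExtGroup A N M₁ i) :=
  (map_injective hf hfg hg h).subsingleton

lemma subsingleton_trd {i : ℕ} (h₂ : Subsingleton (ExtGroup A N M₂ i))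
    (h₁ : Subsingleton (ExtGroup A N M₁ (i + 1))) : Subsingleton (ExtGroup A N M₃ i) := by
  refine subsingleton_of_forall_eq 0 fun e ↦ ?_
  obtain ⟨x, rfl⟩ := Ext.covariant_sequence_exact₃ (ModuleCat.of A N)
    (shortExact_of hf hfg hg) e rfl (Subsingleton.elim (α := ExtGroup A N M₁ (i + 1)) _ _)
  rw [Subsingleton.elim (α := ExtGroup A N M₂ i) x 0, Ext.zero_comp]

end Covariant

section Contravariant

variable {f : N₁ →ₗ[A] N₂} {g : N₂ →ₗ[A] N₃} (hf : Function.Injective f)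
    (hfg : Function.Exact f g) (hg : Function.Surjective g)

include hf hfg hg

lemma subsingleton_left_fst {i : ℕ} (h₂ : Subsingleton (ExtGroup A N₂ M i))
    (h₃ : Subsingleton (ExtGroup A N₃ M (i + 1))) : Subsingleton (ExtGroup A N₁ M i) := by
  refine subsingleton_of_forall_eq 0 fun e ↦ ?_
  obtain ⟨x, rfl⟩ := Ext.contravariant_sequence_exact₁ (shortExact_of hf hfg hg)
    (ModuleCat.of A M) e (add_comm 1 i) (Subsingleton.elim (α := ExtGroup A N₃ M (i + 1)) _ _)
  rw [Subsingleton.elim (α := ExtGroup A N₂ M i) x 0, Ext.comp_zero]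

lemma subsingleton_left_trd {i : ℕ} (h₁ : Subsingleton (ExtGroup A N₁ M i))
    (h₂ : Subsingleton (ExtGroup A N₂ M (i + 1))) :
    Subsingleton (ExtGroup A N₃ M (i + 1)) := by
  refine subsingleton_of_forall_eq 0 fun e ↦ ?_
  obtain ⟨x, rfl⟩ := Ext.contravariant_sequence_exact₃ (shortExact_of hf hfg hg)
    (ModuleCat.of A M) e (Subsingleton.elim (α := ExtGroup A N₂ M (i + 1)) _ _) (add_comm 1 i)
  rw [Subsingleton.elim (α := ExtGroup A N₁ M i) x 0, Ext.comp_zero]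

lemma exists_extension (h₃ : Subsingleton (ExtGroup A N₃ M 1)) (φ : N₁ →ₗ[A] M) :
    ∃ ψ : N₂ →ₗ[A] M, ψ ∘ₗ f = φ := by
  obtain ⟨x, hx⟩ := Ext.contravariant_sequence_exact₁ (shortExact_of hf hfg hg)
    (ModuleCat.of A M) (Ext.mk₀ (ModuleCat.ofHom φ)) (add_zero 1)
    (Subsingleton.elim (α := ExtGroup A N₃ M 1) _ _)
  obtain ⟨y, rfl⟩ := Ext.addEquiv₀.symm.surjective x
  refine ⟨y.hom, ?_⟩
  have h2 : Ext.mk₀ (ModuleCat.ofHom f ≫ y) = Ext.mk₀ (ModuleCat.ofHom φ) := by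
    rw [← hx]
    simp
  have h3 := Ext.addEquiv₀.symm.injective h2
  exact congrArg ModuleCat.Hom.hom h3

lemma subsingleton_one_of_extension (h₂ : Subsingleton (ExtGroup A N₂ M 1))
    (h : ∀ φ : N₁ →ₗ[A] M, ∃ ψ : N₂ →ₗ[A] M, ψ ∘ₗ f = φ) :
    Subsingleton (ExtGroup A N₃ M 1) := by
  refine subsingleton_of_forall_eq 0 fun e ↦ ?_
  obtain ⟨x, rfl⟩ := Ext.contravariant_sequence_exact₃ (shortExact_of hf hfg hg)
    (ModuleCat.of A M) e (Subsingleton.elim (α := ExtGroup A N₂ M 1) _ _) (add_zero 1)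
  obtain ⟨y, rfl⟩ := Ext.addEquiv₀.symm.surjective x
  obtain ⟨ψ, hψ⟩ := h y.hom
  have hy : y = ModuleCat.ofHom f ≫ ModuleCat.ofHom ψ := by
    ext1
    exact hψ.symm
  have h2 : Ext.addEquiv₀.symm y =
      (Ext.mk₀ (ModuleCat.ofHom f)).comp (Ext.mk₀ (ModuleCat.ofHom ψ)) (add_zero 0) := by
    rw [Ext.mk₀_comp_mk₀, hy]
    rfl
  rw [h2]
  exact (shortExact_of hf hfg hg).extClass_comp_assoc _

end Contravariant

end ExtGroup

end

/-! ### Ext vanishing over a Noetherian ring: direct sums and faithfully flat descent -/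

namespace ExtGroup

variable {A : Type u} [CommRing A] {M M' : Type u} [AddCommGroup M] [Module A M]
  [AddCommGroup M'] [Module A M']

/-- Over a Noetherian ring, an implication between vanishing statements for `Ext(N, M)` and
`Ext(N, M')`, uniform in the finitely generated module `N`, only has to be checked in degree `0`
and for the extension of linear maps from submodules of free modules. -/
lemma subsingleton_of_extension_imp [IsNoetherianRing A]
    (h₀ : ∀ (N : Type u) [AddCommGroup N] [Module A N] [Module.Finite A N],
      (∀ f : N →ₗ[A] M, f = 0) → ∀ f : N →ₗ[A] M', f = 0)
    (h₁ : ∀ (n : ℕ) (K : Submodule A (Fin n → A)),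
      (∀ φ : K →ₗ[A] M, ∃ ψ : (Fin n → A) →ₗ[A] M, ψ ∘ₗ K.subtype = φ) →
      ∀ φ : K →ₗ[A] M', ∃ ψ : (Fin n → A) →ₗ[A] M', ψ ∘ₗ K.subtype = φ)
    (i : ℕ) (N : Type u) [AddCommGroup N] [Module A N] [Module.Finite A N]
    (h : Subsingleton (ExtGroup A N M i)) : Subsingleton (ExtGroup A N M' i) := by
  induction i generalizing N with
  | zero =>
    rw [subsingleton_zero_iff] at h ⊢
    exact h₀ N h
  | succ i ih =>
    -- Dimension shifting along this cover, whose kernel is again finitely generated. Degree 1 is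
    -- the extension problem, since Ext^1 of a free module vanishes.
    obtain ⟨n, p, hp⟩ := Module.Finite.exists_fin' A N
    have hex : Function.Exact (LinearMap.ker p).subtype p := LinearMap.exact_subtype_ker_map p
    have hinj := (LinearMap.ker p).subtype_injective
    cases i with
    | zero =>
      exact subsingleton_one_of_extension hinj hex hp (subsingleton_of_projective M' 0)
        (h₁ n _ (exists_extension hinj hex hp h))
    | succ i =>
      exact subsingleton_left_trd hinj hex hp
        (ih _ (subsingleton_left_fst hinj hex hp (subsingleton_of_projective M i) h))
        (subsingleton_of_projective M' (i + 1))

/-- Over a Noetherian ring, vanishing of `Ext(N, -)` passes to countable direct sums. -/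
lemma subsingleton_finsupp [IsNoetherianRing A] (N : Type u) [AddCommGroup N] [Module A N]
    [Module.Finite A N] {i : ℕ} (h : Subsingleton (ExtGroup A N M i)) :
    Subsingleton (ExtGroup A N (ℕ →₀ M) i) := by
  refine subsingleton_of_extension_imp (M := M) ?_ ?_ i N h
  · intro N _ _ _ h f
    ext x j
    exact LinearMap.congr_fun (h (Finsupp.lapply j ∘ₗ f)) x
  · intro n K h φ
    choose ψ hψ using fun j : ℕ ↦ h (Finsupp.lapply j ∘ₗ φ)
    obtain ⟨s, hs⟩ := (inferInstance : Module.Finite A K).fg_top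
    -- Since K is finitely generated, φ involves only finitely many coordinates, so finitely many
    -- extensions suffice.
    let t : Finset ℕ := s.biUnion fun x ↦ (φ x).support
    have ht : ∀ x j, j ∉ t → φ x j = 0 := by
      intro x j hj
      have hle : (⊤ : Submodule A K) ≤ LinearMap.ker (Finsupp.lapply j ∘ₗ φ) := by
        rw [← hs, Submodule.span_le]
        intro y hy
        by_contra hne
        exact hj (Finset.mem_biUnion.mpr ⟨y, hy, Finsupp.mem_support_iff.mpr hne⟩)
      exact hle (x := x) trivial
    refine ⟨∑ j ∈ t, Finsupp.lsingle j ∘ₗ ψ j, ?_⟩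
    ext x j
    have hx : ψ j x = φ x j := LinearMap.congr_fun (hψ j) x
    by_cases hj : j ∈ t
    · simp [Finsupp.finsetSum_apply, Finsupp.single_apply, hj, hx]
    · simp [Finsupp.finsetSum_apply, Finsupp.single_apply, hj, ht]

/-- Vanishing of `Ext(N, -)` over a Noetherian ring descends along faithfully flat base change. -/
lemma subsingleton_of_faithfullyFlat [IsNoetherianRing A] {R : Type u} [CommRing R] [Algebra A R]
    [Module R M] [IsScalarTower A R M] (S : Type u) [CommRing S] [Algebra R S]
    [Module.FaithfullyFlat R S] (Q : Type u) [AddCommGroup Q] [Module A Q] [Module R Q]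
    [IsScalarTower A R Q] (eQ : Q ≃ₗ[R] S ⊗[R] M)
    (N : Type u) [AddCommGroup N] [Module A N]
    [Module.Finite A N] {i : ℕ} (h : Subsingleton (ExtGroup A N Q i)) :
    Subsingleton (ExtGroup A N M i) := by
  let ι : M →ₗ[R] Q := eQ.symm.toLinearMap ∘ₗ TensorProduct.mk R S M 1
  have hι : Function.Injective ι :=
    eQ.symm.injective.comp (Module.FaithfullyFlat.tensorProduct_mk_injective M)
  refine subsingleton_of_extension_imp (M := Q) ?_ ?_ i N h
  · intro N _ _ _ h f
    ext x
    exact hι (by simpa using LinearMap.congr_fun (h (ι.restrictScalars A ∘ₗ f)) x)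
  · intro n K h φ
    obtain ⟨ψ, hψ⟩ := h (ι.restrictScalars A ∘ₗ φ)
    obtain ⟨p, g, hg⟩ := Submodule.fg_iff_exists_fin_generating_family.mp
      (IsNoetherian.noetherian K)
    have hgK : ∀ a, g a ∈ K := fun a ↦ hg ▸ Submodule.subset_span ⟨a, rfl⟩
    -- the linear system whose solutions are the extensions of `φ`
    let L : (Fin n → M) →ₗ[R] (Fin p → M) := LinearMap.pi fun a ↦
      ∑ b, algebraMap A R (g a b) • LinearMap.proj b
    let w : Fin p → M := fun a ↦ φ ⟨g a, hgK a⟩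
    suffices hw : w ∈ LinearMap.range L by
      obtain ⟨z, hz⟩ := hw
      refine ⟨Fintype.linearCombination A z, ?_⟩
      have hspan : Submodule.span A (Set.range fun a ↦ (⟨g a, hgK a⟩ : K)) = ⊤ := by
        apply Submodule.map_injective_of_injective K.subtype_injective
        rw [Submodule.map_span, ← Set.range_comp, Submodule.map_top, Submodule.range_subtype]
        exact hg
      refine LinearMap.ext_on_range hspan fun a ↦ ?_
      have := congrFun hz a
      simpa [L, w, Fintype.linearCombination_apply, algebraMap_smul] using this
    -- Solvability means that w vanishes in the cokernel of L. This may be tested after tensoring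
    -- with S, where ψ supplies a solution.
    rw [← Submodule.Quotient.mk_eq_zero, ← Submodule.mkQ_apply]
    refine Module.FaithfullyFlat.tensorProduct_mk_injective (A := R) (B := S) _ ?_
    rw [_root_.map_zero, TensorProduct.mk_apply]
    have hdecomp : (1 : S) ⊗ₜ[R] (LinearMap.range L).mkQ w =
        ∑ a, (LinearMap.lTensor S ((LinearMap.range L).mkQ ∘ₗ LinearMap.single R (fun _ ↦ M) a))
          ((1 : S) ⊗ₜ[R] w a) := by
      conv_lhs => rw [← Finset.univ_sum_single w]
      simp [TensorProduct.tmul_sum]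
    rw [hdecomp]
    have hwa : ∀ a, (1 : S) ⊗ₜ[R] w a =
        ∑ b, algebraMap A R (g a b) • eQ (ψ (Pi.single b 1)) := by
      intro a
      have h1 := congrArg eQ (LinearMap.congr_fun hψ ⟨g a, hgK a⟩)
      have h2 : g a = ∑ b, g a b • (Pi.single b 1 : Fin n → A) := by
        conv_lhs => rw [← Finset.univ_sum_single (g a)]
        refine Finset.sum_congr rfl fun b _ ↦ ?_
        rw [← Pi.single_smul, smul_eq_mul, mul_one]
      have h3 : eQ (ψ (g a)) = ∑ b, algebraMap A R (g a b) • eQ (ψ (Pi.single b 1)) := by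
        conv_lhs => rw [h2]
        simp only [_root_.map_sum, map_smul]
        refine Finset.sum_congr rfl fun b _ ↦ ?_
        rw [← algebraMap_smul R, map_smul]
      rw [← h3]
      simpa [ι, w] using h1.symm
    have hzero : ∀ (b : Fin n) (t : S ⊗[R] M),
        ∑ a, algebraMap A R (g a b) • (LinearMap.lTensor S
          ((LinearMap.range L).mkQ ∘ₗ LinearMap.single R (fun _ ↦ M) a)) t = 0 := by
      intro b t
      have hmap : ∑ a, algebraMap A R (g a b) •
          ((LinearMap.range L).mkQ ∘ₗ LinearMap.single R (fun _ ↦ M) a) = 0 := by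
        ext x
        simp only [LinearMap.sum_apply, LinearMap.smul_apply, LinearMap.comp_apply,
          LinearMap.zero_apply, ← map_smul, ← _root_.map_sum]
        rw [Submodule.mkQ_apply, Submodule.Quotient.mk_eq_zero]
        refine ⟨Pi.single b x, ?_⟩
        funext a
        simp [L, Finset.sum_apply, Pi.single_apply, Finset.sum_ite_eq]
      have := congrArg (fun l ↦ LinearMap.lTensorHom (R := R) S l t) hmap
      simpa only [_root_.map_sum, map_smul, LinearMap.sum_apply, LinearMap.smul_apply,
        LinearMap.coe_lTensorHom, _root_.map_zero, LinearMap.zero_apply] using this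
    simp only [hwa, _root_.map_sum, map_smul]
    rw [Finset.sum_comm]
    exact Finset.sum_eq_zero fun b _ ↦ hzero b _

end ExtGroup

/-! ### Regular sequences after faithfully flat extension and vanishing of Ext -/

section

open scoped Pointwise

open Polynomial in
/-- McCoy's theorem for modules: a polynomial whose coefficients have no common nonzero annihilated
element in `M` is a nonzerodivisor on `M[X]`. -/
lemma PolynomialModule.isSMulRegular_of_coeff {B : Type*} [CommRing B] {N : Type*}
    [AddCommGroup N] [Module B N] (f : B[X]) (hf : ∀ n : N, (∀ j, f.coeff j • n = 0) → n = 0) :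
    IsSMulRegular (PolynomialModule B N) f := by
  have key : ∀ (d : ℕ) (g : PolynomialModule B N), (∀ i, d ≤ i → g.coeff i = 0) →
      f • g = 0 → g = 0 := by
    intro d
    induction d with
    | zero =>
      intro g hg _
      ext i
      exact hg i (Nat.zero_le i)
    | succ d ih =>
      intro g hg hfg
      -- Descending induction on j: if the higher coefficients of f kill g, the coefficient of f • g
      -- in degree j + d is f_j • g_d. Hence f_j • g has lower degree and is still killed by f, so
      -- the outer induction applies.
      have hkill : ∀ m j, f.natDegree < j + m → f.coeff j • g = 0 := by
        intro m
        induction m with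
        | zero =>
          intro j hj
          rw [coeff_eq_zero_of_natDegree_lt (show f.natDegree < j from hj), zero_smul]
        | succ m ihm =>
          intro j hj
          have hcoeff : ∀ a b, f.coeff a • g.coeff b = (f.coeff a • g).coeff b := fun a b ↦ rfl
          apply ih
          · intro i hi
            rcases hi.eq_or_lt with rfl | hi
            · have h0 : (f • g).coeff (j + d) = 0 := by rw [hfg]; rfl
              rw [PolynomialModule.smul_apply,
                Finset.sum_eq_single (j, d)] at h0
              · exact h0
              · rintro ⟨a, b⟩ hab hne
                rw [Finset.HasAntidiagonal.mem_antidiagonal] at hab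
                dsimp only at hab ⊢
                by_cases hb : d + 1 ≤ b
                · rw [hg b hb, smul_zero]
                · have : b ≠ d := by
                    rintro rfl
                    exact hne (Prod.ext (by simpa using hab) rfl)
                  rw [hcoeff, ihm a (by omega)]
                  rfl
              · intro h
                exact absurd (Finset.HasAntidiagonal.mem_antidiagonal.mpr (rfl : j + d = j + d)) h
            · rw [← hcoeff, hg i hi, smul_zero]
          · have : f • f.coeff j • g = f.coeff j • f • g := by
              rw [← algebraMap_smul B[X] (f.coeff j) g,
                ← algebraMap_smul B[X] (f.coeff j) (f • g), smul_comm]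
            rw [this, hfg, smul_zero]
      ext i
      refine hf _ fun j ↦ ?_
      have := hkill (f.natDegree + 1) j (by omega)
      exact congrArg (fun p ↦ p.coeff i) this
  rw [isSMulRegular_iff_right_eq_zero_of_smul]
  intro g hg
  refine key (g.coeff.support.sup id + 1) g (fun i hi ↦ ?_) hg
  by_contra hne
  have := Finset.le_sup (f := id) (Finsupp.mem_support_iff.mpr hne)
  simp only [id] at this
  omega

namespace ExtGroup

open RingTheory.Sequence

variable {A : Type u} [CommRing A] (J : Ideal A)

/-- Elements of J kill Ext_A(A/J, -). Keeping `f` general in the induction lets coefficients from B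
be absorbed into it. -/
lemma map_restrictScalars_smul_eq_zero {B : Type*} [CommRing B] [Algebra A B] {N₁ N₂ : Type u}
    [AddCommGroup N₁] [Module A N₁] [Module B N₁] [IsScalarTower A B N₁]
    [AddCommGroup N₂] [Module A N₂] [Module B N₂] [IsScalarTower A B N₂]
    {r : B} (hr : r ∈ J.map (algebraMap A B)) (f : N₁ →ₗ[B] N₂) {i : ℕ}
    (e : ExtGroup A (A ⧸ J) N₁ i) :
    map (A ⧸ J) ((r • f).restrictScalars A) i e = 0 := by
  induction hr using Submodule.span_induction generalizing f with
  | mem r hr =>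
    obtain ⟨a, ha, rfl⟩ := hr
    have : (algebraMap A B a • f).restrictScalars A = a • f.restrictScalars A := by
      ext x
      exact algebraMap_smul B a (f x)
    rw [this]
    refine map_smul_eq_zero _ ?_ e
    rwa [Ideal.annihilator_quotient]
  | zero => rw [zero_smul]; exact map_zero e
  | add r s _ _ hr hs =>
    rw [add_smul]
    exact (map_add ((r • f).restrictScalars A) ((s • f).restrictScalars A) e).trans
      (by rw [hr, hs, add_zero])
  | smul b r _ hr =>
    rw [smul_eq_mul, mul_comm, mul_smul]
    exact hr _

section SMulSequence

variable (A) {B : Type*} [CommRing B] [Algebra A B] (r : B) (N : Type u) [AddCommGroup N]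
  [Module A N] [Module B N] [IsScalarTower A B N]

/-- Multiplication by `r`, as an `A`-linear map. -/
def smulRestrict : N →ₗ[A] N := (r • (LinearMap.id : N →ₗ[B] N)).restrictScalars A

/-- The projection `N → N / rN`, as an `A`-linear map. -/
def quotSMulTopRestrict : N →ₗ[A] QuotSMulTop r N :=
  (r • ⊤ : Submodule B N).mkQ.restrictScalars A

lemma exact_smulRestrict : Function.Exact (smulRestrict A r N) (quotSMulTopRestrict A r N) :=
  LinearMap.exact_lsmul_mkQ_smul_top N r

variable {r N} in
lemma injective_smulRestrict (h : IsSMulRegular N r) :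
    Function.Injective (smulRestrict A r N) := fun _ _ hab ↦ h hab

lemma surjective_quotSMulTopRestrict : Function.Surjective (quotSMulTopRestrict A r N) := by
  intro x
  obtain ⟨y, rfl⟩ := Submodule.Quotient.mk_surjective (r • ⊤ : Submodule B N) x
  exact ⟨y, rfl⟩

end SMulSequence

/-- If `JB` contains a weakly regular sequence of length `k` on `N`, then `Ext^i_A(A/J, N) = 0`
for `i < k`. -/
lemma subsingleton_of_isWeaklyRegular {B : Type*} [CommRing B] [Algebra A B] (rs : List B)
    (hrs : ∀ r ∈ rs, r ∈ J.map (algebraMap A B)) (N : Type u)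
    [AddCommGroup N] [Module A N] [Module B N] [IsScalarTower A B N]
    (hreg : IsWeaklyRegular N rs) {i : ℕ} (hi : i < rs.length) :
    Subsingleton (ExtGroup A (A ⧸ J) N i) := by
  induction rs generalizing N i with
  | nil => simp at hi
  | cons r rs ih =>
    rw [isWeaklyRegular_cons_iff] at hreg
    have hN : ∀ j, j + 1 = i → Subsingleton (ExtGroup A (A ⧸ J) (QuotSMulTop r N) j) := by
      rintro j rfl
      exact ih (fun s hs ↦ hrs s (List.mem_cons_of_mem r hs)) _ hreg.2 (by simpa using hi)
    -- Multiplication by r is injective on this Ext group because Ext of the quotient vanishes one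
    -- degree lower. It is also zero, as r lies in JB.
    have hinj := map_injective (N := A ⧸ J) (i := i) (f := smulRestrict A r N)
      (g := quotSMulTopRestrict A r N) (injective_smulRestrict A hreg.1)
      (exact_smulRestrict A r N) (surjective_quotSMulTopRestrict A r N) hN
    refine ⟨fun a b ↦ hinj ?_⟩
    have h0 := fun e ↦ map_restrictScalars_smul_eq_zero J (hrs r List.mem_cons_self)
      (LinearMap.id : N →ₗ[B] N) (i := i) e
    exact (h0 a).trans (h0 b).symm

open Polynomial in
/-- If `Ext^i_A(A/J, N) = 0` for `i < k`, then `JS` contains a weakly regular sequence of length `k`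
on `N ⊗ S` for some faithfully flat `S`. -/
lemma exists_isWeaklyRegular [IsNoetherianRing A] (k : ℕ) (B : Type u) [CommRing B] [Algebra A B]
    (N : Type u) [AddCommGroup N] [Module A N] [Module B N] [IsScalarTower A B N]
    (h : ∀ i < k, Subsingleton (ExtGroup A (A ⧸ J) N i)) :
    ∃ (S : Type u) (_ : CommRing S) (_ : Algebra B S) (_ : Module.FaithfullyFlat B S)
      (rs : List S), rs.length = k ∧
      (∀ r ∈ rs, r ∈ (J.map (algebraMap A B)).map (algebraMap B S)) ∧
      IsWeaklyRegular (S ⊗[B] N) rs := by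
  induction k generalizing B N with
  | zero => exact ⟨B, inferInstance, inferInstance, inferInstance, [], rfl, by simp, by simp⟩
  | succ k ih =>
    obtain ⟨p, x, hx⟩ := Submodule.fg_iff_exists_fin_generating_family.mp (IsNoetherian.noetherian J)
    have hxJ : ∀ j, x j ∈ J := fun j ↦ hx ▸ Submodule.subset_span ⟨j, rfl⟩
    -- The generic element of J: its coefficients are generators of J, so McCoy makes it regular on
    -- N[X] as soon as no nonzero element of N is killed by J, which is vanishing in degree 0.
    let f : B[X] := ∑ j : Fin p, monomial (j : ℕ) (algebraMap A B (x j))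
    have hfJ : f ∈ J.map (algebraMap A B[X]) := by
      refine Ideal.sum_mem _ fun j _ ↦ ?_
      rw [← C_mul_X_pow_eq_monomial]
      exact Ideal.mul_mem_right _ _ (Ideal.mem_map_of_mem (algebraMap A B[X]) (hxJ j))
    have hfcoeff : ∀ j : Fin p, f.coeff j = algebraMap A B (x j) := by
      intro j
      simp [f, coeff_monomial, Fin.val_inj]
    have hann : ∀ n : N, (∀ a ∈ J, a • n = 0) → n = 0 := by
      intro n hn
      have := subsingleton_zero_iff.mp (h 0 k.succ_pos)
        (J.liftQ (LinearMap.toSpanSingleton A N n) hn)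
      exact (one_smul A n).symm.trans (LinearMap.congr_fun this (J.mkQ 1))
    have hreg : IsSMulRegular (PolynomialModule B N) f := by
      refine PolynomialModule.isSMulRegular_of_coeff f fun n hn ↦ hann n ?_
      have hle : J ≤ LinearMap.ker (LinearMap.toSpanSingleton A N n) := by
        rw [← hx, Submodule.span_le]
        rintro _ ⟨j, rfl⟩
        have := hn j
        rw [hfcoeff, algebraMap_smul] at this
        exact this
      exact fun a ha ↦ hle ha
    -- Over A, N[X] is a countable direct sum of copies of N.
    have hP : ∀ i < k + 1, Subsingleton (ExtGroup A (A ⧸ J) (PolynomialModule B N) i) :=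
      fun i hi ↦ (subsingleton_congr_right (PolynomialModule.coeffLinearEquiv B A)).mpr
        (subsingleton_finsupp (A ⧸ J) (h i hi))
    have hQ : ∀ i < k, Subsingleton
        (ExtGroup A (A ⧸ J) (QuotSMulTop f (PolynomialModule B N)) i) := by
      intro i hi
      exact subsingleton_trd (f := smulRestrict A f (PolynomialModule B N))
        (g := quotSMulTopRestrict A f (PolynomialModule B N)) (injective_smulRestrict A hreg)
        (exact_smulRestrict A f _) (surjective_quotSMulTopRestrict A f _) (hP i (by omega)) (hP (i + 1) (by omega))
    obtain ⟨S, _, _, _, rs, hlen, hrs, hrsreg⟩ := ih B[X] _ hQ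
    let _ : Algebra B S := ((algebraMap B[X] S).comp (algebraMap B B[X])).toAlgebra
    have : IsScalarTower B B[X] S := IsScalarTower.of_algebraMap_eq' rfl
    have : Module.FaithfullyFlat B B[X] := .of_linearEquiv _ _ (basisMonomials B).repr
    have hmap : (J.map (algebraMap A B[X])).map (algebraMap B[X] S) =
        (J.map (algebraMap A B)).map (algebraMap B S) := by
      rw [Ideal.map_map, Ideal.map_map]
      rfl
    refine ⟨S, inferInstance, inferInstance, Module.FaithfullyFlat.trans B B[X] S,
      algebraMap B[X] S f :: rs, by simp [hlen], ?_, ?_⟩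
    · rw [← hmap]
      intro r hr
      rcases List.mem_cons.mp hr with rfl | hr
      · exact Ideal.mem_map_of_mem _ hfJ
      · exact hrs r hr
    -- Passing through B[X] identifies S ⊗ N with the base change of N[X], on which f followed by
    -- the inductive sequence is weakly regular.
    · let e : S ⊗[B] N ≃ₗ[S] S ⊗[B[X]] PolynomialModule B N :=
        (TensorProduct.AlgebraTensorModule.cancelBaseChange B B[X] S S N).symm ≪≫ₗ
          TensorProduct.AlgebraTensorModule.congr (LinearEquiv.refl S S)
            (PolynomialModule.polynomialTensorProductLEquivPolynomialModule B N)
      rw [e.isWeaklyRegular_congr, isWeaklyRegular_cons_iff]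
      refine ⟨hreg.of_flat_of_isBaseChange (TensorProduct.isBaseChange B[X] _ S), ?_⟩
      rwa [(QuotSMulTop.algebraMapTensorEquivTensorQuotSMulTop f
        (PolynomialModule B N) S).isWeaklyRegular_congr]

end ExtGroup

end

section

open scoped Pointwise

open RingTheory.Sequence IsLocalRing

namespace ExtGroup

/-- If `JS` contains a weakly regular sequence of length `k` on `M ⊗ S` for some faithfully flat
`S`, then `Ext^i_A(A/J, M) = 0` for `i < k`. -/
lemma subsingleton_of_isWeaklyRegular_tensor {A : Type u} [CommRing A] [IsNoetherianRing A]
    (J : Ideal A) {R : Type u} [CommRing R] [Algebra A R] (M : Type u) [AddCommGroup M]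
    [Module A M] [Module R M] [IsScalarTower A R M] (S : Type u) [CommRing S] [Algebra R S]
    [Module.FaithfullyFlat R S] (rs : List S)
    (hrs : ∀ r ∈ rs, r ∈ (J.map (algebraMap A R)).map (algebraMap R S))
    (hreg : IsWeaklyRegular (S ⊗[R] M) rs) {i : ℕ} (hi : i < rs.length) :
    Subsingleton (ExtGroup A (A ⧸ J) M i) := by
  let _ : Algebra A S := ((algebraMap R S).comp (algebraMap A R)).toAlgebra
  have : IsScalarTower A R S := IsScalarTower.of_algebraMap_eq' rfl
  have : IsScalarTower A R (S ⊗[R] M) := .of_algebraMap_smul fun a t ↦ by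
    induction t using TensorProduct.induction_on with
    | zero => simp
    | tmul s m => rw [TensorProduct.smul_tmul', TensorProduct.smul_tmul', algebraMap_smul]
    | add s t hs ht => rw [smul_add, smul_add, hs, ht]
  refine subsingleton_of_faithfullyFlat S (S ⊗[R] M) (LinearEquiv.refl R _) (A ⧸ J)
    (subsingleton_of_isWeaklyRegular J rs ?_ (S ⊗[R] M) hreg hi)
  rw [Ideal.map_map] at hrs
  exact hrs

end ExtGroup

/-! ### Depth through finite subsets of the maximal ideal -/

section FinsetDepth

variable {R : Type u} [CommRing R]

/-- The subring generated by a finite set. -/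
abbrev finsetSubring (x : Finset R) : Subalgebra ℤ R := Algebra.adjoin ℤ (x : Set R)

/-- The ideal generated by `x` in the subring generated by `x`. -/
def finsetIdeal (x : Finset R) : Ideal (finsetSubring x) :=
  Ideal.span (Subtype.val ⁻¹' (x : Set R))

instance (x : Finset R) : IsNoetherianRing (finsetSubring x) :=
  have : Algebra.FiniteType ℤ (finsetSubring x) :=
    Subalgebra.fg_iff_finiteType _ |>.mp (Subalgebra.fg_adjoin_finset x)
  Algebra.FiniteType.isNoetherianRing ℤ _

lemma map_finsetIdeal (x : Finset R) :
    (finsetIdeal x).map (algebraMap (finsetSubring x) R) = Ideal.span (x : Set R) := by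
  rw [finsetIdeal, Ideal.map_span]
  congr 1
  ext r
  constructor
  · rintro ⟨a, ha, rfl⟩
    exact ha
  · intro hr
    exact ⟨⟨r, Algebra.subset_adjoin hr⟩, hr, rfl⟩

/-- The canonical module structure on a quotient ring. -/
abbrev quotientModule (A : Type u) [CommRing A] (J : Ideal A) : Module A (A ⧸ J) := inferInstance

/-- A shortcut instance. -/
instance (x : Finset R) : Module (finsetSubring x) (finsetSubring x ⧸ finsetIdeal x) :=
  quotientModule _ _

/-- The local `Ext`-type cohomology of `M` with respect to a finite set `x`, with coefficients
restricted to the (Noetherian) subring generated by `x`. It has the same vanishing range as Koszul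
cohomology. -/
abbrev FinsetExt (x : Finset R) (M : Type u) [AddCommGroup M] [Module R M] (i : ℕ) : Type u :=
  ExtGroup (finsetSubring x) (finsetSubring x ⧸ finsetIdeal x) M i

/-- `FinsetExt x M` vanishes in degrees `< k`. -/
def FinsetExtVanishes (x : Finset R) (M : Type u) [AddCommGroup M] [Module R M] (k : ℕ) : Prop :=
  ∀ i < k, Subsingleton (FinsetExt x M i)

variable (M : Type u) [AddCommGroup M] [Module R M]

lemma finsetExtVanishes_of_isWeaklyRegular (x : Finset R) (S : Type u) [CommRing S] [Algebra R S]
    [Module.FaithfullyFlat R S] (rs : List S)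
    (hrs : ∀ r ∈ rs, r ∈ (Ideal.span (x : Set R)).map (algebraMap R S))
    (hreg : IsWeaklyRegular (S ⊗[R] M) rs) : FinsetExtVanishes x M rs.length := fun i hi ↦
  ExtGroup.subsingleton_of_isWeaklyRegular_tensor (finsetIdeal x) M S rs
    (by rwa [map_finsetIdeal]) hreg hi

variable {M}

lemma FinsetExtVanishes.exists_isWeaklyRegular {x : Finset R} {k : ℕ}
    (h : FinsetExtVanishes x M k) :
    ∃ (S : Type u) (_ : CommRing S) (_ : Algebra R S) (_ : Module.FaithfullyFlat R S)
      (rs : List S), rs.length = k ∧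
      (∀ r ∈ rs, r ∈ (Ideal.span (x : Set R)).map (algebraMap R S)) ∧
      IsWeaklyRegular (S ⊗[R] M) rs := by
  have := ExtGroup.exists_isWeaklyRegular (finsetIdeal x) k R M h
  rwa [map_finsetIdeal] at this

/-- Enlarging x changes the coefficient ring as well as the ideal, so Ext groups are not compared
directly. The description by regular sequences depends only on the ideal. -/
lemma FinsetExtVanishes.mono {x y : Finset R} (hxy : x ⊆ y) {k : ℕ}
    (h : FinsetExtVanishes x M k) : FinsetExtVanishes y M k := by
  obtain ⟨S, _, _, _, rs, rfl, hrs, hreg⟩ := h.exists_isWeaklyRegular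
  exact finsetExtVanishes_of_isWeaklyRegular M y S rs
    (fun r hr ↦ Ideal.map_mono (Ideal.span_mono (Finset.coe_subset.mpr hxy)) (hrs r hr)) hreg

lemma FinsetExtVanishes.le {x : Finset R} {j k : ℕ} (hjk : j ≤ k)
    (h : FinsetExtVanishes x M k) : FinsetExtVanishes x M j :=
  fun i hi ↦ h i (hi.trans_le hjk)

variable [IsLocalRing R]

variable (R M) in
/-- `DepthGE R M k` says that the depth of `M` is at least `k`, in terms of `FinsetExt`. -/
def DepthGE (k : ℕ) : Prop :=
  ∃ x : Finset R, (x : Set R) ⊆ maximalIdeal R ∧ FinsetExtVanishes x M k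

variable (R M) in
lemma DepthGE.zero : DepthGE R M 0 := ⟨∅, by simp, fun i hi ↦ absurd hi (Nat.not_lt_zero i)⟩

lemma DepthGE.le {j k : ℕ} (hjk : j ≤ k) (h : DepthGE R M k) : DepthGE R M j :=
  let ⟨x, hx, h⟩ := h
  ⟨x, hx, h.le hjk⟩

/-- By Nakayama M/mM is nonzero. It stays nonzero over S and is killed by mS, so the sequence cannot
generate all of S ⊗ M. -/
lemma isRegular_of_mem_map_maximalIdeal [Module.Finite R M] [Nontrivial M] (S : Type u) [CommRing S]
    [Algebra R S] [Module.FaithfullyFlat R S] {rs : List S}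
    (hrs : ∀ r ∈ rs, r ∈ (maximalIdeal R).map (algebraMap R S))
    (hreg : IsWeaklyRegular (S ⊗[R] M) rs) : IsRegular (S ⊗[R] M) rs := by
  refine ⟨hreg, fun htop ↦ ?_⟩
  have hlt : maximalIdeal R • (⊤ : Submodule R M) ≠ ⊤ := fun h ↦
    top_ne_bot (α := Submodule R M) <| Submodule.eq_bot_of_le_smul_of_le_jacobson_bot
      (maximalIdeal R) ⊤ Module.Finite.fg_top h.ge (maximalIdeal_le_jacobson _)
  have : Nontrivial (M ⧸ maximalIdeal R • (⊤ : Submodule R M)) :=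
    Submodule.Quotient.nontrivial_iff.mpr hlt
  let q : S ⊗[R] M →ₗ[S] S ⊗[R] (M ⧸ maximalIdeal R • (⊤ : Submodule R M)) :=
    (Submodule.mkQ _).baseChange S
  have hq : Function.Surjective q := LinearMap.lTensor_surjective S (Submodule.mkQ_surjective _)
  have hle : Ideal.ofList rs • (⊤ : Submodule S (S ⊗[R] M)) ≤ LinearMap.ker q := by
    have h1 : Ideal.ofList rs ≤ (maximalIdeal R).map (algebraMap R S) :=
      Ideal.span_le.mpr hrs
    refine (Submodule.smul_mono_left h1).trans ?_
    rw [Submodule.smul_le]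
    intro s hs t _
    rw [LinearMap.mem_ker, map_smul]
    generalize q t = t'
    have h2 : (maximalIdeal R).map (algebraMap R S) ≤
        Module.annihilator S (S ⊗[R] (M ⧸ maximalIdeal R • (⊤ : Submodule R M))) := by
      rw [Ideal.map_le_iff_le_comap]
      intro a ha
      rw [Ideal.mem_comap, Module.mem_annihilator]
      intro t
      rw [algebraMap_smul]
      induction t using TensorProduct.induction_on with
      | zero => simp
      | tmul s m =>
        obtain ⟨m, rfl⟩ := Submodule.Quotient.mk_surjective _ m
        rw [← TensorProduct.tmul_smul, ← Submodule.Quotient.mk_smul,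
          (Submodule.Quotient.mk_eq_zero _).mpr (Submodule.smul_mem_smul ha Submodule.mem_top),
          TensorProduct.tmul_zero]
      | add s t hs ht => rw [smul_add, hs, ht, add_zero]
    exact Module.mem_annihilator.mp (h2 hs) t'
  rw [← htop, top_le_iff, LinearMap.ker_eq_top] at hle
  obtain ⟨t, ht⟩ := exists_ne (0 : S ⊗[R] (M ⧸ maximalIdeal R • (⊤ : Submodule R M)))
  obtain ⟨t, rfl⟩ := hq t
  exact ht (by rw [hle]; rfl)

lemma natCast_le_localDepth_iff [Module.Finite R M] [Nontrivial M] (k : ℕ) :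
    (k : ℕ∞) ≤ localDepth R M ↔ DepthGE R M k := by
  constructor
  · intro h
    cases k with
    | zero => exact DepthGE.zero R M
    | succ k =>
      have hlt : (k : ℕ∞) < localDepth R M :=
        (ENat.natCast_lt_natCast.mpr k.lt_succ_self).trans_le h
      simp only [localDepth, idealDepth, classicalDepth, lt_iSup_iff] at hlt
      obtain ⟨S, _, _, _, rs, hrs, hreg, hk⟩ := hlt
      have hk' : k < rs.length := ENat.natCast_lt_natCast.mp hk
      -- Each term of the sequence is a combination of finitely many elements of m.
      have hfin : ∃ x : Finset R, (x : Set R) ⊆ maximalIdeal R ∧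
          ∀ r ∈ rs, r ∈ (Ideal.span (x : Set R)).map (algebraMap R S) := by
        clear hreg hk hk'
        classical
        induction rs with
        | nil => exact ⟨∅, by simp, by simp⟩
        | cons r rs ih =>
          obtain ⟨x, hx, hxr⟩ := ih fun s hs ↦ hrs s (List.mem_cons_of_mem r hs)
          obtain ⟨t, ht, hrt⟩ := Submodule.mem_span_finite_of_mem_span
            (hrs r List.mem_cons_self)
          obtain ⟨y, hy, rfl⟩ := Finset.subset_set_image_iff.mp ht
          refine ⟨x ∪ y, by simpa using ⟨hx, hy⟩, ?_⟩
          intro s hs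
          rcases List.mem_cons.mp hs with rfl | hs
          · rw [Ideal.map_span]
            refine Ideal.span_mono ?_ hrt
            rw [Finset.coe_image]
            exact Set.image_mono (by simp)
          · exact Ideal.map_mono (Ideal.span_mono (by simp)) (hxr s hs)
      obtain ⟨x, hx, hxr⟩ := hfin
      exact ⟨x, hx, (finsetExtVanishes_of_isWeaklyRegular M x S rs hxr
        hreg.toIsWeaklyRegular).le hk'⟩
  · rintro ⟨x, hx, h⟩
    obtain ⟨S, _, _, _, rs, rfl, hrs, hreg⟩ := h.exists_isWeaklyRegular
    have hrs' : ∀ r ∈ rs, r ∈ (maximalIdeal R).map (algebraMap R S) :=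
      fun r hr ↦ Ideal.map_mono (Ideal.span_le.mpr hx) (hrs r hr)
    unfold localDepth idealDepth classicalDepth
    exact le_iSup_of_le S <| le_iSup_of_le _ <| le_iSup_of_le _ <| le_iSup_of_le ‹_› <|
      le_iSup_of_le rs <| le_iSup_of_le hrs' <|
      le_iSup_of_le (isRegular_of_mem_map_maximalIdeal S hrs' hreg) le_rfl

lemma localDepth_congr {M : Type u} {M' : Type v} [AddCommGroup M] [Module R M] [AddCommGroup M']
    [Module R M'] (e : M ≃ₗ[R] M') : localDepth R M = localDepth R M' := by
  unfold localDepth idealDepth classicalDepth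
  simp only [fun (S : Type u) [CommRing S] [Algebra R S] (rs : List S) ↦
    (TensorProduct.AlgebraTensorModule.congr (LinearEquiv.refl S S) e).isRegular_congr rs]

end FinsetDepth

end

/-! ### Finiteness conditions (FP)_n in short exact sequences -/

/-- A recursive form of `IsFPn`. -/
def HasFP (R : Type u) [CommRing R] : ℕ → ∀ (M : Type u) [AddCommGroup M] [Module R M], Prop
  | 0, M, _, _ => Module.Finite R M
  | n + 1, M, _, _ => ∃ (k : ℕ) (p : (Fin k → R) →ₗ[R] M),
      Function.Surjective p ∧ HasFP R n (LinearMap.ker p)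

namespace HasFP

variable {R : Type u} [CommRing R] {K G M M' : Type u} [AddCommGroup K] [Module R K]
  [AddCommGroup G] [Module R G] [AddCommGroup M] [Module R M] [AddCommGroup M'] [Module R M']

lemma congr {n : ℕ} (e : M ≃ₗ[R] M') (h : HasFP R n M) : HasFP R n M' := by
  cases n with
  | zero =>
    have : Module.Finite R M := h
    exact Module.Finite.equiv e
  | succ n =>
    obtain ⟨k, p, hp, hk⟩ := h
    refine ⟨k, e.toLinearMap ∘ₗ p, e.surjective.comp hp, ?_⟩
    rwa [LinearEquiv.ker_comp]

lemma finite {n : ℕ} (h : HasFP R n M) : Module.Finite R M := by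
  cases n with
  | zero => exact h
  | succ n =>
    obtain ⟨k, p, hp, -⟩ := h
    exact Module.Finite.of_surjective p hp

lemma of_succ {n : ℕ} (h : HasFP R (n + 1) M) : HasFP R n M := by
  induction n generalizing M with
  | zero => exact h.finite
  | succ n ih =>
    obtain ⟨k, p, hp, hk⟩ := h
    exact ⟨k, p, hp, ih hk⟩

lemma of_free_surjective {n : ℕ} (F : Type u) [AddCommGroup F] [Module R F] [Module.Free R F]
    [Module.Finite R F] (p : F →ₗ[R] M) (hp : Function.Surjective p)
    (h : HasFP R n (LinearMap.ker p)) : HasFP R (n + 1) M := by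
  let b := (Module.Free.chooseBasis R F).reindex (Fintype.equivFin _)
  let e := b.equivFun
  refine ⟨_, p ∘ₗ e.symm.toLinearMap, hp.comp e.symm.surjective, congr ?_ h⟩
  rw [LinearMap.ker_comp, Submodule.comap_equiv_eq_map_symm]
  exact e.submoduleMap _

lemma of_subsingleton (n : ℕ) [Subsingleton M] : HasFP R n M := by
  induction n generalizing M with
  | zero => exact (inferInstance : Module.Finite R M)
  | succ n ih => exact of_free_surjective M LinearMap.id Function.surjective_id ih

lemma of_free (n : ℕ) [Module.Free R M] [Module.Finite R M] : HasFP R n M := by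
  cases n with
  | zero => exact (inferInstance : Module.Finite R M)
  | succ n =>
    have : Subsingleton (LinearMap.ker (LinearMap.id : M →ₗ[R] M)) := by
      rw [LinearMap.ker_id]; infer_instance
    exact of_free_surjective M LinearMap.id Function.surjective_id (of_subsingleton n)

variable {f : K →ₗ[R] G} {g : G →ₗ[R] M}

/-- Horseshoe argument: free covers of the two ends combine to one of the middle, and the kernels
again form a short exact sequence. -/
lemma middle {n : ℕ} (hf : Function.Injective f) (hfg : Function.Exact f g)
    (hg : Function.Surjective g) (hK : HasFP R n K) (hM : HasFP R n M) : HasFP R n G := by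
  induction n generalizing K G M with
  | zero =>
    have : Module.Finite R K := hK
    have : Module.Finite R M := hM
    refine ⟨Submodule.fg_of_fg_map_of_fg_inf_ker g ?_ ?_⟩
    · rw [Submodule.map_top, LinearMap.range_eq_top.mpr hg]
      exact Module.Finite.fg_top
    · rw [top_inf_eq, hfg.linearMap_ker_eq, ← Submodule.map_top]
      exact Module.Finite.fg_top.map f
  | succ n ih =>
    obtain ⟨a, p, hp, hkp⟩ := hK
    obtain ⟨b, q, hq, hkq⟩ := hM
    obtain ⟨q', hq'⟩ := Module.projective_lifting_property g q hg
    have hgq : ∀ y, g (q' y) = q y := fun y ↦ LinearMap.congr_fun hq' y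
    let P : ((Fin a → R) × (Fin b → R)) →ₗ[R] G := (f ∘ₗ p).coprod q'
    have hgP : ∀ z, g (P z) = q z.2 := by
      intro z
      simp [P, hfg.apply_apply_eq_zero, hgq]
    refine of_free_surjective _ P ?_ ?_
    · intro t
      obtain ⟨y, hy⟩ := hq (g t)
      obtain ⟨s, hs⟩ := (hfg (t - q' y)).mp (by rw [map_sub, hgq, hy, sub_self])
      obtain ⟨x, rfl⟩ := hp s
      exact ⟨(x, y), by simp [P, hs]⟩
    · let i : LinearMap.ker p →ₗ[R] LinearMap.ker P :=
        ((LinearMap.inl R _ _) ∘ₗ (LinearMap.ker p).subtype).codRestrict _ fun x ↦ by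
          simp [P, LinearMap.mem_ker.mp x.2]
      let j : LinearMap.ker P →ₗ[R] LinearMap.ker q :=
        ((LinearMap.snd R _ _) ∘ₗ (LinearMap.ker P).subtype).codRestrict _ fun z ↦ by
          have := hgP z
          rw [LinearMap.mem_ker.mp z.2, map_zero] at this
          exact this.symm
      refine ih (f := i) (g := j) ?_ ?_ ?_ hkp hkq
      · intro x y hxy
        exact Subtype.ext (congrArg (fun z : LinearMap.ker P ↦ z.1.1) hxy)
      · intro z
        constructor
        · intro hz
          have hz2 : z.1.2 = 0 := congrArg Subtype.val hz
          have hz1 : p z.1.1 = 0 := hf (.trans (b := 0) (by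
            have : f (p z.1.1) + q' z.1.2 = 0 := z.2
            rwa [hz2, map_zero, add_zero] at this) (map_zero f).symm)
          exact ⟨⟨z.1.1, hz1⟩, Subtype.ext (Prod.ext rfl hz2.symm)⟩
        · rintro ⟨x, rfl⟩
          rfl
      · intro y
        obtain ⟨s, hs⟩ := (hfg (q' y)).mp (by rw [hgq]; exact y.2)
        obtain ⟨x, rfl⟩ := hp s
        exact ⟨⟨(-x, y), by simp [P, hs]⟩, rfl⟩

/-- A cover p of G is also one of M, and its new kernel is an extension of ker g ≅ K by ker p. -/
lemma cokernel {n : ℕ} (hf : Function.Injective f) (hfg : Function.Exact f g)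
    (hg : Function.Surjective g) (hK : HasFP R n K) (hG : HasFP R (n + 1) G) :
    HasFP R (n + 1) M := by
  obtain ⟨k, p, hp, hkp⟩ := hG
  refine ⟨k, g ∘ₗ p, hg.comp hp, ?_⟩
  have hker : HasFP R n (LinearMap.ker g) := congr
    (LinearEquiv.ofInjective f hf ≪≫ₗ LinearEquiv.ofEq _ _ hfg.linearMap_ker_eq.symm) hK
  have hle : LinearMap.ker p ≤ LinearMap.ker (g ∘ₗ p) := LinearMap.ker_le_ker_comp p g
  let j : LinearMap.ker (g ∘ₗ p) →ₗ[R] LinearMap.ker g :=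
    (p ∘ₗ (LinearMap.ker (g ∘ₗ p)).subtype).codRestrict _ fun x ↦ x.2
  refine middle (f := Submodule.inclusion hle) (g := j) (Submodule.inclusion_injective hle)
    ?_ ?_ hkp hker
  · intro z
    constructor
    · intro hz
      exact ⟨⟨z, congrArg Subtype.val hz⟩, rfl⟩
    · rintro ⟨x, rfl⟩
      exact Subtype.ext x.2
  · intro y
    obtain ⟨x, hx⟩ := hp y
    exact ⟨⟨x, show g (p x) = 0 by rw [hx]; exact y.2⟩, Subtype.ext hx⟩

/-- As in Schanuel's lemma: with q a free cover of M lifted to G, the map K × R^k → G is onto with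
kernel isomorphic to ker q. So K × R^k is (FP)_n, and the free summand can be cancelled. -/
lemma kernel {n : ℕ} (hf : Function.Injective f) (hfg : Function.Exact f g)
    (hg : Function.Surjective g) (hG : HasFP R n G) (hM : HasFP R (n + 1) M) :
    HasFP R n K := by
  obtain ⟨k, q, hq, hkq⟩ := hM
  obtain ⟨σ, hσ⟩ := Module.projective_lifting_property g q hg
  have hgσ : ∀ y, g (σ y) = q y := fun y ↦ LinearMap.congr_fun hσ y
  have hprod : HasFP R n (LinearMap.ker (f.coprod σ)) := by
    have hmem : ∀ z : LinearMap.ker (f.coprod σ), z.1.2 ∈ LinearMap.ker q := by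
      intro z
      have h0 : f z.1.1 + σ z.1.2 = 0 := z.2
      have := congrArg g h0
      rwa [map_add, hfg.apply_apply_eq_zero, hgσ, zero_add, map_zero] at this
    refine congr (LinearEquiv.ofBijective
      (((LinearMap.snd R _ _) ∘ₗ (LinearMap.ker (f.coprod σ)).subtype).codRestrict _ hmem)
      ⟨?_, ?_⟩).symm hkq
    · rw [injective_iff_map_eq_zero]
      intro z hz
      have hz2 : z.1.2 = 0 := congrArg Subtype.val hz
      have hz1 : z.1.1 = 0 := hf (.trans (b := 0) (by
        have : f z.1.1 + σ z.1.2 = 0 := z.2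
        rwa [hz2, map_zero, add_zero] at this) (map_zero f).symm)
      exact Subtype.ext (Prod.ext hz1 hz2)
    · intro y
      obtain ⟨s, hs⟩ := (hfg (σ y)).mp (by rw [hgσ]; exact y.2)
      exact ⟨⟨(-s, y), by simp [hs]⟩, rfl⟩
  have hKF : HasFP R n (K × (Fin k → R)) := by
    refine middle (LinearMap.ker (f.coprod σ)).subtype_injective
      (LinearMap.exact_subtype_ker_map _) ?_ hprod hG
    intro t
    obtain ⟨y, hy⟩ := hq (g t)
    obtain ⟨s, hs⟩ := (hfg (t - σ y)).mp (by rw [map_sub, hgσ, hy, sub_self])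
    exact ⟨(s, y), by simp [hs]⟩
  cases n with
  | zero =>
    have : Module.Finite R (K × (Fin k → R)) := hKF
    exact Module.Finite.of_surjective (LinearMap.fst R K (Fin k → R)) Prod.fst_surjective
  | succ n =>
    exact cokernel (f := LinearMap.inr R K (Fin k → R)) (g := LinearMap.fst R K (Fin k → R))
      LinearMap.inr_injective Function.Exact.inr_fst Prod.fst_surjective (of_free n) hKF

end HasFP

lemma isFPn_iff_hasFP {R : Type u} [CommRing R] {M : Type u} [AddCommGroup M] [Module R M]
    {n : ℕ} : IsFPn R M n ↔ HasFP R n M := by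
  induction n generalizing M with
  | zero =>
    constructor
    · rintro ⟨k, -, ε, hε, -⟩
      exact Module.Finite.of_surjective ε hε
    · intro h
      have : Module.Finite R M := h
      obtain ⟨k, p, hp⟩ := Module.Finite.exists_fin' R M
      exact ⟨fun _ ↦ k, fun _ ↦ 0, p, hp, by omega, by omega⟩
  | succ n ih =>
    constructor
    · rintro ⟨k, d, ε, hε, h0, hd⟩
      refine ⟨k 0, ε, hε, ih.mp ?_⟩
      have h0 := h0 (by omega)
      refine ⟨fun i ↦ k (i + 1), fun i ↦ d (i + 1),
        (d 0).codRestrict _ fun x ↦ h0.apply_apply_eq_zero x, ?_, ?_, ?_⟩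
      · intro y
        obtain ⟨x, hx⟩ := (h0 y).mp y.2
        exact ⟨x, Subtype.ext hx⟩
      · intro hn x
        rw [← hd 0 (by omega) x]
        exact Subtype.ext_iff
      · exact fun i hi ↦ hd (i + 1) (by omega)
    · rintro ⟨k, p, hp, hk⟩
      obtain ⟨k', d', ε', hε', h0', hd'⟩ := ih.mpr hk
      refine ⟨fun | 0 => k | i + 1 => k' i,
        fun | 0 => (LinearMap.ker p).subtype ∘ₗ ε' | i + 1 => d' i, p, hp, ?_, ?_⟩
      · intro _ x
        constructor
        · intro hx
          obtain ⟨y, hy⟩ := hε' ⟨x, hx⟩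
          exact ⟨y, congrArg Subtype.val hy⟩
        · rintro ⟨y, rfl⟩
          exact (ε' y).2
      · intro i hi
        cases i with
        | zero =>
          intro x
          exact (Subtype.ext_iff (a1 := ε' x) (a2 := 0)).symm.trans (h0' (by omega) x)
        | succ i => exact hd' i (by omega)

namespace IsFPInfinity

variable {R : Type u} [CommRing R] {K G M M' : Type u} [AddCommGroup K] [Module R K]
  [AddCommGroup G] [Module R G] [AddCommGroup M] [Module R M] [AddCommGroup M'] [Module R M']
  {f : K →ₗ[R] G} {g : G →ₗ[R] M}

lemma finite (h : IsFPInfinity R M) : Module.Finite R M := isFPn_iff_hasFP.mp (h 0)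

lemma congr (e : M ≃ₗ[R] M') (h : IsFPInfinity R M) : IsFPInfinity R M' :=
  fun n ↦ isFPn_iff_hasFP.mpr ((isFPn_iff_hasFP.mp (h n)).congr e)

lemma of_free [Module.Free R M] [Module.Finite R M] : IsFPInfinity R M :=
  fun n ↦ isFPn_iff_hasFP.mpr (HasFP.of_free n)

lemma cokernel (hf : Function.Injective f) (hfg : Function.Exact f g)
    (hg : Function.Surjective g) (hK : IsFPInfinity R K) (hG : IsFPInfinity R G) :
    IsFPInfinity R M := fun n ↦ isFPn_iff_hasFP.mpr <| HasFP.of_succ <|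
  HasFP.cokernel hf hfg hg (isFPn_iff_hasFP.mp (hK n)) (isFPn_iff_hasFP.mp (hG (n + 1)))

lemma kernel (hf : Function.Injective f) (hfg : Function.Exact f g)
    (hg : Function.Surjective g) (hG : IsFPInfinity R G) (hM : IsFPInfinity R M) :
    IsFPInfinity R K := fun n ↦ isFPn_iff_hasFP.mpr <|
  HasFP.kernel hf hfg hg (isFPn_iff_hasFP.mp (hG n)) (isFPn_iff_hasFP.mp (hM (n + 1)))

end IsFPInfinity

/-! ### The restricted G-class: duality, kernels, cokernels, embeddings in free modules -/

section Dual

variable {R : Type u} [CommRing R] {K G M M' : Type u} [AddCommGroup K] [Module R K]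
  [AddCommGroup G] [Module R G] [AddCommGroup M] [Module R M] [AddCommGroup M'] [Module R M']
  {f : K →ₗ[R] G} {g : G →ₗ[R] M}

open Module

lemma exact_dualMap (hfg : Function.Exact f g) (hg : Function.Surjective g) :
    Function.Exact g.dualMap f.dualMap :=
  LinearMap.exact_lcomp_of_exact_of_surjective R hfg hg

lemma surjective_dualMap (hf : Function.Injective f) (hfg : Function.Exact f g)
    (hg : Function.Surjective g) (hM : Subsingleton (ExtGroup R M R 1)) :
    Function.Surjective f.dualMap := fun φ ↦ ExtGroup.exists_extension hf hfg hg hM φ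

namespace IsRestrictedGClass

lemma congr (e : M ≃ₗ[R] M') (h : IsRestrictedGClass R M) : IsRestrictedGClass R M' where
  gClass :=
    { finite := have := h.gClass.finite; Module.Finite.equiv e
      ext_self := fun i hi ↦
        (ExtGroup.subsingleton_congr_left e).mp (h.gClass.ext_self i hi)
      ext_dual := fun i hi ↦
        (ExtGroup.subsingleton_congr_left e.dualMap.symm).mp (h.gClass.ext_dual i hi)
      reflexive := by
        have : IsReflexive R M := ⟨h.gClass.reflexive⟩
        exact (Module.equiv e).bijective_dual_eval' }
  fpInfinity := h.fpInfinity.congr e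
  fpInfinity_dual := h.fpInfinity_dual.congr e.dualMap.symm

lemma of_free [Module.Free R M] [Module.Finite R M] : IsRestrictedGClass R M where
  gClass :=
    { finite := inferInstance
      ext_self := fun
        | 0, hi => absurd hi (lt_irrefl 0)
        | i + 1, _ => ExtGroup.subsingleton_of_projective R i
      ext_dual := fun
        | 0, hi => absurd hi (lt_irrefl 0)
        | i + 1, _ => ExtGroup.subsingleton_of_projective R i
      reflexive := bijective_dual_eval R M }
  fpInfinity := .of_free
  fpInfinity_dual := .of_free

lemma dual (h : IsRestrictedGClass R M) : IsRestrictedGClass R (Dual R M) := by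
  have hr : IsReflexive R M := ⟨h.gClass.reflexive⟩
  exact
  { gClass :=
    { finite := h.fpInfinity_dual.finite
      ext_self := h.gClass.ext_dual
      ext_dual := fun i hi ↦
        (ExtGroup.subsingleton_congr_left (evalEquiv R M)).mp (h.gClass.ext_self i hi)
      reflexive := bijective_dual_eval R (Dual R M) }
    fpInfinity := h.fpInfinity_dual
    fpInfinity_dual := h.fpInfinity.congr (evalEquiv R M) }

/-- Since Ext^1(M, R) = 0, the dual sequence is again short exact. The long exact sequences and a
diagram chase in the double duals do the rest. -/
lemma kernel (hf : Function.Injective f) (hfg : Function.Exact f g)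
    (hg : Function.Surjective g) (hG : IsRestrictedGClass R G) (hM : IsRestrictedGClass R M) :
    IsRestrictedGClass R K := by
  have hinj := LinearMap.dualMap_injective_of_surjective hg
  have hex := exact_dualMap hfg hg
  have hsurj := surjective_dualMap hf hfg hg (hM.gClass.ext_self 1 one_pos)
  have hfp := IsFPInfinity.kernel hf hfg hg hG.fpInfinity hM.fpInfinity
  refine ⟨⟨hfp.finite, ?_, ?_, ?_, ?_⟩, hfp, .cokernel hinj hex hsurj hM.fpInfinity_dual
    hG.fpInfinity_dual⟩
  · exact fun i hi ↦ ExtGroup.subsingleton_left_fst hf hfg hg (hG.gClass.ext_self i hi)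
      (hM.gClass.ext_self (i + 1) i.succ_pos)
  · intro i hi
    match i, hi with
    -- Degree 1 is not covered by the shift: here a functional on M* is evaluation at some m, and it
    -- extends to G* as evaluation at a lift of m.
    | 1, _ =>
      refine ExtGroup.subsingleton_one_of_extension hinj hex hsurj
        (hG.gClass.ext_dual 1 one_pos) fun φ ↦ ?_
      obtain ⟨m, rfl⟩ := hM.gClass.reflexive.2 φ
      obtain ⟨y, rfl⟩ := hg m
      exact ⟨Dual.eval R G y, rfl⟩
    | i + 2, _ =>
      exact ExtGroup.subsingleton_left_trd hinj hex hsurj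
        (hM.gClass.ext_dual (i + 1) i.succ_pos) (hG.gClass.ext_dual (i + 2) (i + 1).succ_pos)
  · rw [injective_iff_map_eq_zero]
    intro x hx
    apply hf
    rw [map_zero]
    apply hG.gClass.reflexive.1
    rw [map_zero]
    ext ψ
    exact LinearMap.congr_fun hx (f.dualMap ψ)
  · intro Φ
    obtain ⟨y, hy⟩ := hG.gClass.reflexive.2 (Φ ∘ₗ f.dualMap)
    have hgy : g y = 0 := by
      apply hM.gClass.reflexive.1
      rw [map_zero]
      ext χ
      refine (LinearMap.congr_fun hy (g.dualMap χ)).trans ?_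
      rw [LinearMap.comp_apply, hex.apply_apply_eq_zero, map_zero]
      rfl
    obtain ⟨x, rfl⟩ := (hfg y).mp hgy
    refine ⟨x, ?_⟩
    ext χ
    obtain ⟨ψ, rfl⟩ := hsurj χ
    exact LinearMap.congr_fun hy ψ

/-- Surjectivity on duals puts M* in the class as a kernel. Comparison with the exact bidual
sequence makes M reflexive, so M is the dual of M*. -/
lemma cokernel (hfg : Function.Exact f g)
    (hg : Function.Surjective g) (hK : IsRestrictedGClass R K) (hG : IsRestrictedGClass R G)
    (hM : Function.Surjective f.dualMap) : IsRestrictedGClass R M := by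
  have hinj := LinearMap.dualMap_injective_of_surjective hg
  have hex := exact_dualMap hfg hg
  have hdual : IsRestrictedGClass R (Dual R M) := kernel hinj hex hM hG.dual hK.dual
  have hrefl : Function.Bijective (Dual.eval R M) := by
    constructor
    · rw [injective_iff_map_eq_zero]
      intro m hm
      obtain ⟨y, rfl⟩ := hg m
      obtain ⟨Φ, hΦ⟩ := (exact_dualMap hex hM (Dual.eval R G y)).mp hm
      obtain ⟨x, rfl⟩ := hK.gClass.reflexive.2 Φ
      have : y = f x := hG.gClass.reflexive.1 hΦ.symm
      rw [this, hfg.apply_apply_eq_zero]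
    · intro Ψ
      obtain ⟨Θ, hΘ⟩ := surjective_dualMap hinj hex hM (hK.gClass.ext_dual 1 one_pos) Ψ
      obtain ⟨y, rfl⟩ := hG.gClass.reflexive.2 Θ
      exact ⟨g y, hΘ⟩
  exact hdual.dual.congr (LinearEquiv.ofBijective _ hrefl).symm

variable {P : Type u} [AddCommGroup P] [Module R P]

/-- The embedding of a module into the dual of a free module that maps onto its dual. -/
def dualEmbedding (p : P →ₗ[R] Dual R G) : G →ₗ[R] Dual R P := p.dualMap ∘ₗ Dual.eval R G

variable {p : P →ₗ[R] Dual R G} (hp : Function.Surjective p) (hG : IsRestrictedGClass R G)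
include hp hG

lemma ker_of_surjective [Module.Free R P] [Module.Finite R P] : IsRestrictedGClass R (LinearMap.ker p) :=
  kernel (LinearMap.ker p).subtype_injective (LinearMap.exact_subtype_ker_map p) hp of_free hG.dual

lemma injective_dualEmbedding : Function.Injective (dualEmbedding p) :=
  (LinearMap.dualMap_injective_of_surjective hp).comp hG.gClass.reflexive.1

lemma exact_dualEmbedding : Function.Exact (dualEmbedding p) (LinearMap.ker p).subtype.dualMap := by
  intro φ
  rw [exact_dualMap (LinearMap.exact_subtype_ker_map p) hp φ]
  constructor
  · rintro ⟨Φ, rfl⟩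
    obtain ⟨x, rfl⟩ := hG.gClass.reflexive.2 Φ
    exact ⟨x, rfl⟩
  · rintro ⟨x, rfl⟩
    exact ⟨Dual.eval R G x, rfl⟩

lemma surjective_dualMap_subtype : Function.Surjective (LinearMap.ker p).subtype.dualMap :=
  surjective_dualMap (LinearMap.ker p).subtype_injective (LinearMap.exact_subtype_ker_map p) hp
    (hG.dual.gClass.ext_self 1 one_pos)

end IsRestrictedGClass

end Dual

/-! ### Cohomology of modules in the restricted G-class -/

section FinsetExt

variable {R : Type u} [CommRing R] {K G M M' : Type u} [AddCommGroup K] [Module R K]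
  [AddCommGroup G] [Module R G] [AddCommGroup M] [Module R M] [AddCommGroup M'] [Module R M']

namespace FinsetExt

variable (x : Finset R)

/-- Functoriality of `FinsetExt`. -/
noncomputable def map (f : M →ₗ[R] M') (i : ℕ) : FinsetExt x M i →+ FinsetExt x M' i :=
  ExtGroup.map (finsetSubring x ⧸ finsetIdeal x) (f.restrictScalars (finsetSubring x)) i

variable {x}

lemma map_id {i : ℕ} (e : FinsetExt x M i) : map x LinearMap.id i e = e := ExtGroup.map_id e

lemma map_comp (f : K →ₗ[R] G) (g : G →ₗ[R] M) {i : ℕ} (e : FinsetExt x K i) :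
    map x (g ∘ₗ f) i e = map x g i (map x f i e) :=
  ExtGroup.map_comp (f.restrictScalars _) (g.restrictScalars _) e

lemma map_add (f g : M →ₗ[R] M') {i : ℕ} (e : FinsetExt x M i) :
    map x (f + g) i e = map x f i e + map x g i e :=
  ExtGroup.map_add (f.restrictScalars _) (g.restrictScalars _) e

lemma map_zero {i : ℕ} (e : FinsetExt x M i) : map x (0 : M →ₗ[R] M') i e = 0 :=
  ExtGroup.map_zero e

lemma map_sum {ι : Type*} (s : Finset ι) (f : ι → M →ₗ[R] M') {i : ℕ}
    (e : FinsetExt x M i) : map x (∑ j ∈ s, f j) i e = ∑ j ∈ s, map x (f j) i e := by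
  classical
  induction s using Finset.induction_on with
  | empty => simp [map_zero]
  | insert a s ha ih => rw [Finset.sum_insert ha, Finset.sum_insert ha, map_add, ih]

lemma map_smul_eq_zero {r : R} (hr : r ∈ x) (f : M →ₗ[R] M') {i : ℕ} (e : FinsetExt x M i) :
    map x (r • f) i e = 0 :=
  ExtGroup.map_restrictScalars_smul_eq_zero (finsetIdeal x)
    (by rw [map_finsetIdeal]; exact Ideal.subset_span hr) f e

lemma subsingleton_congr (e : M ≃ₗ[R] M') {i : ℕ} :
    Subsingleton (FinsetExt x M i) ↔ Subsingleton (FinsetExt x M' i) :=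
  ExtGroup.subsingleton_congr_right (e.restrictScalars (finsetSubring x))

lemma subsingleton_of_free {i : ℕ} (h : Subsingleton (FinsetExt x R i)) [Module.Free R M]
    [Module.Finite R M] : Subsingleton (FinsetExt x M i) := by
  let b := Module.Free.chooseBasis R M
  rw [subsingleton_congr b.equivFun]
  refine subsingleton_of_forall_eq 0 fun e ↦ ?_
  have hid : (LinearMap.id : (Module.Free.ChooseBasisIndex R M → R) →ₗ[R] _) =
      ∑ j, LinearMap.single R (fun _ ↦ R) j ∘ₗ LinearMap.proj j := by
    ext
    simp [Pi.single_apply]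
  rw [← map_id e, hid, map_sum]
  refine Finset.sum_eq_zero fun j _ ↦ ?_
  rw [map_comp, Subsingleton.elim (map x (LinearMap.proj j) i e) 0, _root_.map_zero]

/-- The map is a matrix whose entries all lie in x, and each entry acts as zero. This is where "x
large enough" is exploited. -/
lemma map_toSpanSingleton_dual_eq_zero {n : ℕ} (u : Module.Dual R (Fin n → R))
    (hu : ∀ j, u (Pi.single j 1) ∈ x) {i : ℕ} (e : FinsetExt x R i) :
    map x (LinearMap.toSpanSingleton R _ u) i e = 0 := by
  have : LinearMap.toSpanSingleton R _ u = ∑ j, u (Pi.single j 1) •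
      LinearMap.toSpanSingleton R (Module.Dual R (Fin n → R)) (LinearMap.proj j) := by
    ext j
    simp [LinearMap.sum_apply, Pi.single_apply]
  rw [this, map_sum]
  exact Finset.sum_eq_zero fun j _ ↦ map_smul_eq_zero (hu j) _ e

section Exact

variable {f : K →ₗ[R] G} {g : G →ₗ[R] M} (hf : Function.Injective f)
    (hfg : Function.Exact f g) (hg : Function.Surjective g)

include hf hfg hg

lemma exists_map_eq {i : ℕ} (e : FinsetExt x G i) (he : map x g i e = 0) :
    ∃ e', map x f i e' = e :=
  ExtGroup.exists_map_eq (f := f.restrictScalars (finsetSubring x))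
    (g := g.restrictScalars (finsetSubring x)) hf hfg hg e he

lemma map_injective {i : ℕ} (h : ∀ j, j + 1 = i → Subsingleton (FinsetExt x M j)) :
    Function.Injective (map x f i) :=
  ExtGroup.map_injective (f := f.restrictScalars (finsetSubring x))
    (g := g.restrictScalars (finsetSubring x)) hf hfg hg h

lemma subsingleton_fst {i : ℕ} (h : ∀ j, j + 1 = i → Subsingleton (FinsetExt x M j))
    (h₂ : Subsingleton (FinsetExt x G i)) : Subsingleton (FinsetExt x K i) :=
  ExtGroup.subsingleton_fst (f := f.restrictScalars (finsetSubring x))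
    (g := g.restrictScalars (finsetSubring x)) hf hfg hg h h₂

lemma subsingleton_trd {i : ℕ} (h₂ : Subsingleton (FinsetExt x G i))
    (h₁ : Subsingleton (FinsetExt x K (i + 1))) : Subsingleton (FinsetExt x M i) :=
  ExtGroup.subsingleton_trd (f := f.restrictScalars (finsetSubring x))
    (g := g.restrictScalars (finsetSubring x)) hf hfg hg h₂ h₁

end Exact

end FinsetExt

open IsRestrictedGClass in
-- Along 0 → G → P* → (ker p)* → 0, degree i of G is controlled by degree i of a free module and
-- degree i - 1 of another member of the class.
lemma FinsetExtVanishes.of_isRestrictedGClass {x : Finset R} {k : ℕ}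
    (h : FinsetExtVanishes x R k) (hG : IsRestrictedGClass R G) : FinsetExtVanishes x G k := by
  intro i hi
  induction i generalizing G with
  | zero =>
    obtain ⟨n, p, hp⟩ := (have := hG.fpInfinity_dual.finite
      Module.Finite.exists_fin' R (Module.Dual R G))
    exact FinsetExt.subsingleton_fst (injective_dualEmbedding hp hG) (exact_dualEmbedding hp hG)
      (surjective_dualMap_subtype hp hG) (by omega) (FinsetExt.subsingleton_of_free (h 0 hi))
  | succ i ih =>
    obtain ⟨n, p, hp⟩ := (have := hG.fpInfinity_dual.finite
      Module.Finite.exists_fin' R (Module.Dual R G))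
    refine FinsetExt.subsingleton_fst (injective_dualEmbedding hp hG) (exact_dualEmbedding hp hG)
      (surjective_dualMap_subtype hp hG) ?_ (FinsetExt.subsingleton_of_free (h _ hi))
    rintro j hj
    obtain rfl : j = i := by omega
    exact ih (ker_of_surjective hp hG).dual (by omega)

open IsRestrictedGClass in
lemma FinsetExt.map_dualEmbedding_injective {x : Finset R} {k : ℕ} (h : FinsetExtVanishes x R k)
    (hG : IsRestrictedGClass R G) {P : Type u} [AddCommGroup P] [Module R P] [Module.Free R P]
    [Module.Finite R P] {p : P →ₗ[R] Module.Dual R G} (hp : Function.Surjective p) :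
    Function.Injective (map x (dualEmbedding p) k) :=
  map_injective (injective_dualEmbedding hp hG) (exact_dualEmbedding hp hG)
    (surjective_dualMap_subtype hp hG) fun j hj ↦
      h.of_isRestrictedGClass (ker_of_surjective hp hG).dual j (by omega)

end FinsetExt

/-! ### The key lemma: maps that are not surjective on duals -/

section Key

variable {R : Type u} [CommRing R] [IsLocalRing R] {K G : Type u} [AddCommGroup K] [Module R K]
  [AddCommGroup G] [Module R G]

open Module IsLocalRing IsRestrictedGClass

lemma exists_surjective_residue_of_nontrivial (E : Type u) [AddCommGroup E] [Module R E]
    [Module.Finite R E] [Nontrivial E] :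
    ∃ θ : E →ₗ[R] R ⧸ maximalIdeal R, Function.Surjective θ := by
  obtain ⟨N, hN, -⟩ := (eq_top_or_exists_le_coatom (⊥ : Submodule R E)).resolve_left bot_ne_top
  obtain ⟨I, hI, ⟨e⟩⟩ := isSimpleModule_iff_quot_maximal.mp (isSimpleModule_iff_isCoatom.mpr hN)
  obtain rfl := eq_maximalIdeal hI
  exact ⟨e.toLinearMap ∘ₗ N.mkQ, e.surjective.comp N.mkQ_surjective⟩

/-- If a map `φ` of modules in the restricted G-class is not surjective on duals, then it is not
injective on the first nonvanishing cohomology, for all sufficiently large finite subsets of the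
maximal ideal. -/
lemma exists_map_eq_zero_of_not_surjective_dualMap (hK : IsRestrictedGClass R K)
    (hG : IsRestrictedGClass R G) (φ : K →ₗ[R] G) (hφ : ¬ Function.Surjective φ.dualMap) :
    ∃ y : Finset R, (y : Set R) ⊆ maximalIdeal R ∧ ∀ (x : Finset R) (k : ℕ), y ⊆ x →
      FinsetExtVanishes x R k → ¬ Subsingleton (FinsetExt x R k) →
      ∃ t : FinsetExt x K k, t ≠ 0 ∧ FinsetExt.map x φ k t = 0 := by
  classical
  have := hK.fpInfinity_dual.finite
  have := hG.fpInfinity_dual.finite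
  have : Nontrivial (Dual R K ⧸ LinearMap.range φ.dualMap) :=
    Submodule.Quotient.nontrivial_iff.mpr fun h ↦ hφ (LinearMap.range_eq_top.mp h)
  obtain ⟨θ', hθ'⟩ := exists_surjective_residue_of_nontrivial (R := R)
    (Dual R K ⧸ LinearMap.range φ.dualMap)
  -- A functional to the residue field that detects the failure of surjectivity: it is nonzero and
  -- kills the image of the dual map.
  let θ : Dual R K →ₗ[R] R ⧸ maximalIdeal R := θ' ∘ₗ (LinearMap.range φ.dualMap).mkQ
  have hθφ : ∀ ψ, θ (φ.dualMap ψ) = 0 := by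
    intro ψ
    have : (LinearMap.range φ.dualMap).mkQ (φ.dualMap ψ) = 0 :=
      (Submodule.Quotient.mk_eq_zero _).mpr ⟨ψ, rfl⟩
    rw [LinearMap.comp_apply, this, map_zero]
  obtain ⟨e₀, he₀⟩ := (hθ'.comp (Submodule.mkQ_surjective _)) (1 : R ⧸ maximalIdeal R)
  have he₀ : θ e₀ = 1 := he₀
  obtain ⟨a, p', hp'⟩ := Module.Finite.exists_fin' R (Dual R K)
  obtain ⟨c, hc⟩ := Module.projective_lifting_property (maximalIdeal R).mkQ (θ ∘ₗ p')
    (Submodule.mkQ_surjective _)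
  have hc : ∀ z, (maximalIdeal R).mkQ (c z) = θ (p' z) := fun z ↦ LinearMap.congr_fun hc z
  -- a free cover of the dual of `K` such that `θ ∘ p` is the reduction of the first coordinate
  let p : R × (Fin a → R) →ₗ[R] Dual R K :=
    (LinearMap.toSpanSingleton R _ e₀).coprod (p' - LinearMap.toSpanSingleton R _ e₀ ∘ₗ c)
  have hpapp : ∀ z, p z = z.1 • e₀ + (p' z.2 - c z.2 • e₀) := fun z ↦ rfl
  have hp : Function.Surjective p := by
    intro ψ
    obtain ⟨z, rfl⟩ := hp' ψ
    exact ⟨(c z, z), by rw [hpapp]; abel⟩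
  have hres : ∀ r : R, r • (1 : R ⧸ maximalIdeal R) = (maximalIdeal R).mkQ r := by
    intro r
    rw [Algebra.smul_def, mul_one]
    rfl
  have hθp : ∀ z, θ (p z) = 0 → z.1 ∈ maximalIdeal R := by
    intro z hz
    rw [hpapp, map_add, map_sub, map_smul, map_smul, he₀, hres, hres, hc, sub_self,
      add_zero] at hz
    exact (Submodule.Quotient.mk_eq_zero _).mp hz
  have hL := ker_of_surjective hp hK
  have := hL.fpInfinity.finite
  obtain ⟨b, q, hq⟩ := Module.Finite.exists_fin' R (LinearMap.ker p)
  obtain ⟨n, π, hπ⟩ := Module.Finite.exists_fin' R (Dual R G)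
  obtain ⟨l, hl⟩ := Module.projective_lifting_property p (φ.dualMap ∘ₗ π) hp
  have hl : ∀ z, p (l z) = φ.dualMap (π z) := fun z ↦ LinearMap.congr_fun hl z
  let fst : Dual R (R × (Fin a → R)) := LinearMap.fst R R (Fin a → R)
  -- First coordinates of the relations of K* and of a lift of the dual of φ. Both lie in m because
  -- θ vanishes there, and their finitely many entries are what x must contain.
  let u : Dual R (Fin b → R) := fst ∘ₗ (LinearMap.ker p).subtype ∘ₗ q
  let w : Dual R (Fin n → R) := fst ∘ₗ l
  have hu : ∀ z, u z ∈ maximalIdeal R := fun z ↦ hθp _ 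
    ((congrArg θ (show p _ = 0 from (q z).2)).trans (map_zero θ))
  have hw : ∀ z, w z ∈ maximalIdeal R := fun z ↦ hθp _ (by rw [hl, hθφ])
  refine ⟨Finset.univ.image (fun j ↦ u (Pi.single j 1)) ∪
    Finset.univ.image (fun j ↦ w (Pi.single j 1)), ?_, ?_⟩
  · intro r hr
    simp only [Finset.coe_union, Finset.coe_image, Finset.coe_univ, Set.image_univ,
      Set.mem_union, Set.mem_range] at hr
    rcases hr with ⟨j, rfl⟩ | ⟨j, rfl⟩
    · exact hu _
    · exact hw _
  · intro x k hx hvan hne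
    have hux : ∀ j, u (Pi.single j 1) ∈ x := fun j ↦ hx (Finset.mem_union_left _
      (Finset.mem_image_of_mem _ (Finset.mem_univ j)))
    have hwx : ∀ j, w (Pi.single j 1) ∈ x := fun j ↦ hx (Finset.mem_union_right _
      (Finset.mem_image_of_mem _ (Finset.mem_univ j)))
    obtain ⟨h, hh⟩ : ∃ h : FinsetExt x R k, h ≠ 0 := by
      by_contra! hall
      exact hne (subsingleton_of_forall_eq 0 hall)
    let ι : R →ₗ[R] Dual R (R × (Fin a → R)) := LinearMap.toSpanSingleton R _ fst
    let ev : Dual R (R × (Fin a → R)) →ₗ[R] R := Dual.eval R _ (1, 0)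
    have hevι : ev ∘ₗ ι = LinearMap.id := by
      ext
      simp [ev, ι, fst]
    have hιh : FinsetExt.map x ι k h ≠ 0 := by
      intro h0
      apply hh
      rw [← FinsetExt.map_id h, ← hevι, FinsetExt.map_comp, h0, map_zero]
    -- the class of `ι` lifts to `K`
    let q' : (Fin b → R) →ₗ[R] Dual R (Dual R (LinearMap.ker p)) := Dual.eval R _ ∘ₗ q
    have hq' : Function.Surjective q' := hL.gClass.reflexive.2.comp hq
    have hLinj := FinsetExt.map_dualEmbedding_injective hvan hL.dual hq'
    have hlift : FinsetExt.map x (LinearMap.ker p).subtype.dualMap k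
        (FinsetExt.map x ι k h) = 0 := by
      -- Inside the dual of R^b the class becomes h multiplied by the entries of u, which is zero.
      apply hLinj
      rw [← FinsetExt.map_comp, ← FinsetExt.map_comp, map_zero]
      exact FinsetExt.map_toSpanSingleton_dual_eq_zero u hux h
    obtain ⟨t, ht⟩ := FinsetExt.exists_map_eq (injective_dualEmbedding hp hK)
      (exact_dualEmbedding hp hK) (surjective_dualMap_subtype hp hK) _ hlift
    refine ⟨t, ?_, ?_⟩
    · rintro rfl
      exact hιh (by rw [← ht, map_zero])
    · apply FinsetExt.map_dualEmbedding_injective hvan hG hπ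
      -- Likewise the image of t, seen inside the dual of R^n, is h multiplied by the entries of w.
      have hcomm : dualEmbedding π ∘ₗ φ = l.dualMap ∘ₗ dualEmbedding p := by
        ext s z
        exact (LinearMap.congr_fun (hl _) s).symm
      rw [← FinsetExt.map_comp, hcomm, FinsetExt.map_comp, ht, ← FinsetExt.map_comp, map_zero]
      exact FinsetExt.map_toSpanSingleton_dual_eq_zero w hwx h

end Key

/-! ### The depth formula by induction on G-dimension -/

section GDim

variable {R : Type u} [CommRing R] {K G M M' : Type u} [AddCommGroup K] [Module R K]
  [AddCommGroup G] [Module R G] [AddCommGroup M] [Module R M] [AddCommGroup M'] [Module R M']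

open Module IsLocalRing

/-- A recursive form of `restrictedGDim R M ≤ n`. -/
def HasGDimLE (R : Type u) [CommRing R] :
    ℕ → ∀ (M : Type u) [AddCommGroup M] [Module R M], Prop
  | 0, M, _, _ => IsRestrictedGClass R M
  | n + 1, M, _, _ => ∃ (G : ModuleCat.{u} R) (f : G →ₗ[R] M), IsRestrictedGClass R G ∧
      Function.Surjective f ∧ HasGDimLE R n (LinearMap.ker f)

lemma HasGDimLE.congr {n : ℕ} (e : M ≃ₗ[R] M') (h : HasGDimLE R n M) : HasGDimLE R n M' := by
  cases n with
  | zero => exact IsRestrictedGClass.congr e h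
  | succ n =>
    obtain ⟨G, f, hG, hf, hk⟩ := h
    refine ⟨G, e.toLinearMap ∘ₗ f, hG, e.surjective.comp hf, ?_⟩
    rwa [LinearEquiv.ker_comp]

lemma HasGDimLE.finite {n : ℕ} (h : HasGDimLE R n M) : Module.Finite R M := by
  cases n with
  | zero => exact h.fpInfinity.finite
  | succ n =>
    obtain ⟨G, f, hG, hf, -⟩ := h
    have := hG.fpInfinity.finite
    exact Module.Finite.of_surjective f hf

variable [IsLocalRing R]

lemma DepthGE.of_isRestrictedGClass {k : ℕ} (h : DepthGE R R k) (hG : IsRestrictedGClass R G) :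
    DepthGE R G k :=
  let ⟨x, hx, hvan⟩ := h
  ⟨x, hx, hvan.of_isRestrictedGClass hG⟩

lemma union_subset_maximalIdeal [DecidableEq R] {x y : Finset R}
    (hx : (x : Set R) ⊆ maximalIdeal R)
    (hy : (y : Set R) ⊆ maximalIdeal R) : ((x ∪ y : Finset R) : Set R) ⊆ maximalIdeal R := by
  simpa using ⟨hx, hy⟩

/-- If a map of modules in the restricted G-class is injective on cohomology in degree `k`, but not
surjective on duals, then the depth of `R` is not `k`. -/
lemma DepthGE.succ_of_injective {k : ℕ} (h : DepthGE R R k) (hK : IsRestrictedGClass R K)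
    (hG : IsRestrictedGClass R G) (φ : K →ₗ[R] G) (hφ : ¬ Function.Surjective φ.dualMap)
    (z : Finset R) (hz : (z : Set R) ⊆ maximalIdeal R)
    (hinj : ∀ x, z ⊆ x → Function.Injective (FinsetExt.map x φ k)) : DepthGE R R (k + 1) := by
  classical
  by_contra hdepth
  obtain ⟨w, hw, hwvan⟩ := h
  obtain ⟨y, hy, hkey⟩ := exists_map_eq_zero_of_not_surjective_dualMap hK hG φ hφ
  -- Large enough for the vanishing, the key lemma and the injectivity at once. As depth R is not k
  -- + 1 or more, H^k_x(R) is nonzero.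
  let x := w ∪ y ∪ z
  have hwx : w ⊆ x := Finset.subset_union_left.trans Finset.subset_union_left
  have hyx : y ⊆ x := Finset.subset_union_right.trans Finset.subset_union_left
  have hx : (x : Set R) ⊆ maximalIdeal R :=
    union_subset_maximalIdeal (union_subset_maximalIdeal hw hy) hz
  have hvan : FinsetExtVanishes x R k := hwvan.mono hwx
  obtain ⟨t, ht, ht0⟩ := hkey x k hyx hvan fun hsub ↦ hdepth ⟨x, hx, fun i hi ↦ by
    rcases Nat.lt_succ_iff_lt_or_eq.mp hi with hi | rfl
    · exact hvan i hi
    · exact hsub⟩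
  exact ht (hinj x Finset.subset_union_right (by rw [ht0, map_zero]))

/-- The key lemma is applied to M → 0: surjectivity on duals would force M* = 0, hence M = 0 by
reflexivity. -/
lemma depthGE_iff_of_isRestrictedGClass [Nontrivial M] (hM : IsRestrictedGClass R M) (k : ℕ) :
    DepthGE R M k ↔ DepthGE R R k := by
  refine ⟨fun ⟨x, hx, hvan⟩ ↦ ?_, fun h ↦ h.of_isRestrictedGClass hM⟩
  -- The bound climbs one degree at a time, since `DepthGE.succ_of_injective` needs depth R ≥ j
  -- beforehand.
  have key : ∀ j ≤ k, DepthGE R R j := by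
    intro j
    induction j with
    | zero => exact fun _ ↦ DepthGE.zero R R
    | succ j ih =>
      intro hj
      refine (ih (by omega)).succ_of_injective hM (G := PUnit) .of_free 0 ?_ x hx ?_
      · intro hsurj
        obtain ⟨m, hm⟩ := exists_ne (0 : M)
        refine hm (hM.gClass.reflexive.1 ?_)
        ext ψ
        obtain ⟨χ, rfl⟩ := hsurj ψ
        rfl
      · intro y hxy a b _
        have := hvan.mono hxy j hj
        exact Subsingleton.elim a b
  exact key k le_rfl

section ShortExact

variable {f : K →ₗ[R] G} {g : G →ₗ[R] M} (hf : Function.Injective f)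
    (hfg : Function.Exact f g) (hg : Function.Surjective g)

include hf hfg hg

lemma DepthGE.cokernel {k : ℕ} (hK : DepthGE R K (k + 1)) (hG : DepthGE R G k) :
    DepthGE R M k := by
  classical
  obtain ⟨x, hx, hKx⟩ := hK
  obtain ⟨y, hy, hGy⟩ := hG
  exact ⟨x ∪ y, union_subset_maximalIdeal hx hy, fun i hi ↦
    FinsetExt.subsingleton_trd hf hfg hg (hGy.mono Finset.subset_union_right i hi)
      (hKx.mono Finset.subset_union_left (i + 1) (by omega))⟩

lemma DepthGE.kernel {k : ℕ} (hG : DepthGE R G (k + 1)) (hM : DepthGE R M k) :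
    DepthGE R K (k + 1) := by
  classical
  obtain ⟨x, hx, hMx⟩ := hM
  obtain ⟨y, hy, hGy⟩ := hG
  exact ⟨x ∪ y, union_subset_maximalIdeal hx hy, fun i hi ↦
    FinsetExt.subsingleton_fst hf hfg hg
      (fun j hj ↦ hMx.mono Finset.subset_union_left j (by omega))
      (hGy.mono Finset.subset_union_right i hi)⟩

end ShortExact

lemma depthGE_iff_of_hasGDimLE (n : ℕ) [Nontrivial M] (h : HasGDimLE R n M)
    (hmin : ∀ j < n, ¬ HasGDimLE R j M) (k : ℕ) : DepthGE R M k ↔ DepthGE R R (k + n) := by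
  induction n generalizing M k with
  | zero => exact depthGE_iff_of_isRestrictedGClass h k
  | succ n ih =>
    obtain ⟨G, f, hG, hf, hK⟩ := h
    have hinj := (LinearMap.ker f).subtype_injective
    have hex : Function.Exact (LinearMap.ker f).subtype f := LinearMap.exact_subtype_ker_map f
    cases n with
    | zero =>
      have hK : IsRestrictedGClass R (LinearMap.ker f) := hK
      -- Otherwise M would itself be in the class, contrary to minimality.
      have hdual : ¬ Function.Surjective (LinearMap.ker f).subtype.dualMap := fun hsurj ↦
        hmin 0 zero_lt_one (IsRestrictedGClass.cokernel hex hf hK hG hsurj)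
      refine ⟨fun ⟨x, hx, hvan⟩ ↦ ?_, fun h ↦ DepthGE.cokernel hinj hex hf
        (h.of_isRestrictedGClass hK) ((h.le k.le_succ).of_isRestrictedGClass hG)⟩
      have key : ∀ j ≤ k + 1, DepthGE R R j := by
        intro j
        induction j with
        | zero => exact fun _ ↦ DepthGE.zero R R
        | succ j ih =>
          intro hj
          exact (ih (by omega)).succ_of_injective hK hG _ hdual x hx fun y hxy ↦
            FinsetExt.map_injective hinj hex hf fun i hi ↦ hvan.mono hxy i (by omega)
      exact key (k + 1) le_rfl
    | succ n =>
      have hminK : ∀ j < n + 1, ¬ HasGDimLE R j (LinearMap.ker f) := fun j hj hKj ↦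
        hmin (j + 1) (by omega) ⟨G, f, hG, hf, hKj⟩
      -- A zero syzygy would have G-dimension 0.
      have : Nontrivial (LinearMap.ker f) := by
        by_contra hsub
        rw [not_nontrivial_iff_subsingleton] at hsub
        exact hminK 0 n.succ_pos IsRestrictedGClass.of_free
      have ihK := fun k ↦ ih hK hminK k
      have hshift : DepthGE R R (k + (n + 1 + 1)) ↔ DepthGE R (LinearMap.ker f) (k + 1) := by
        rw [ihK, show k + (n + 1 + 1) = k + 1 + (n + 1) by omega]
      rw [hshift]
      constructor
      · intro hM
        -- Bootstrapping: depth K ≥ j gives depth R ≥ j + n + 1, hence depth G ≥ j + 1, and the long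
        -- exact sequence then raises depth K to j + 1.
        have key : ∀ j ≤ k + 1, DepthGE R (LinearMap.ker f) j := by
          intro j
          induction j with
          | zero => exact fun _ ↦ DepthGE.zero R _
          | succ j ihj =>
            intro hj
            have hR := (ihK j).mp (ihj (by omega))
            exact DepthGE.kernel hinj hex hf
              ((hR.le (by omega)).of_isRestrictedGClass hG) (hM.le (by omega))
        exact key (k + 1) le_rfl
      · intro hKk
        exact DepthGE.cokernel hinj hex hf hKk
          ((hshift.mpr hKk).le (by omega) |>.of_isRestrictedGClass hG)

end GDim

/-! ### Resolutions of finite length and the recursive G-dimension -/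

section Resolution

variable {R : Type u} [CommRing R]

namespace RestrictedGResolution

/-- Transport of a resolution along a linear equivalence. -/
def congr {M : Type*} [AddCommGroup M] [Module R M] {M' : Type*} [AddCommGroup M'] [Module R M']
    (res : RestrictedGResolution R M) (e : M ≃ₗ[R] M') : RestrictedGResolution R M' where
  G := res.G
  d := res.d
  ε := e.toLinearMap ∘ₗ res.ε
  mem := res.mem
  surjective := e.surjective.comp res.surjective
  exact_zero := fun x ↦ by
    rw [← res.exact_zero x]
    exact e.map_eq_zero_iff
  exact_succ := res.exact_succ

/-- Truncation of a resolution, to a resolution of the first syzygy. -/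
def truncate {M : Type*} [AddCommGroup M] [Module R M] (res : RestrictedGResolution R M) :
    RestrictedGResolution R (LinearMap.ker res.ε) where
  G i := res.G (i + 1)
  d i := res.d (i + 1)
  ε := (res.d 0).codRestrict _ fun x ↦ res.exact_zero.apply_apply_eq_zero x
  mem i := res.mem (i + 1)
  surjective y :=
    let ⟨x, hx⟩ := (res.exact_zero y).mp y.2
    ⟨x, Subtype.ext hx⟩
  exact_zero x := by
    rw [← res.exact_succ 0 x]
    exact Subtype.ext_iff
  exact_succ i := res.exact_succ (i + 1)

lemma length_le_iff {M : Type*} [AddCommGroup M] [Module R M] (res : RestrictedGResolution R M)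
    (n : ℕ) : res.length ≤ n ↔ ∀ i, n < i → Subsingleton (res.G i) := by
  simp only [length, iSup_le_iff, Nat.cast_le, ← not_nontrivial_iff_subsingleton]
  exact forall_congr' fun i ↦ ⟨fun h hi hn ↦ absurd (h hn) (by omega), fun h hn ↦ by
    by_contra hi
    exact h (by omega) hn⟩

lemma hasGDimLE {M : Type u} [AddCommGroup M] [Module R M] (res : RestrictedGResolution R M)
    {n : ℕ} (h : ∀ i, n < i → Subsingleton (res.G i)) : HasGDimLE R n M := by
  induction n generalizing M with
  | zero =>
    have hinj : Function.Injective res.ε := by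
      rw [injective_iff_map_eq_zero]
      intro x hx
      obtain ⟨y, rfl⟩ := (res.exact_zero x).mp hx
      have := h 1 one_pos
      rw [Subsingleton.elim y 0, map_zero]
    exact (res.mem 0).congr (LinearEquiv.ofBijective res.ε ⟨hinj, res.surjective⟩)
  | succ n ih =>
    exact ⟨res.G 0, res.ε, res.mem 0, res.surjective,
      ih res.truncate fun i hi ↦ h (i + 1) (by omega)⟩

end RestrictedGResolution

lemma HasGDimLE.exists_resolution {M : Type u} [AddCommGroup M] [Module R M] {n : ℕ}
    (h : HasGDimLE R n M) :
    ∃ res : RestrictedGResolution R M, ∀ i, n < i → Subsingleton (res.G i) := by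
  induction n generalizing M with
  | zero =>
    refine ⟨{ G := fun | 0 => ModuleCat.of R M | _ + 1 => ModuleCat.of R PUnit
              d := fun _ ↦ 0
              ε := LinearMap.id
              mem := fun | 0 => h | _ + 1 => IsRestrictedGClass.of_free (M := PUnit)
              surjective := Function.surjective_id
              exact_zero := fun x ↦ ⟨fun hx ↦ ⟨0, hx.symm⟩, fun ⟨_, hx⟩ ↦ hx.symm⟩
              exact_succ := fun i x ↦ ⟨fun _ ↦ ⟨0, rfl⟩, fun _ ↦ rfl⟩ }, ?_⟩
    intro i hi
    match i, hi with
    | i + 1, _ => exact (inferInstance : Subsingleton PUnit)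
  | succ n ih =>
    obtain ⟨G, f, hG, hf, hK⟩ := h
    obtain ⟨res, hres⟩ := ih hK
    refine ⟨{ G := fun | 0 => G | i + 1 => res.G i
              d := fun | 0 => (LinearMap.ker f).subtype ∘ₗ res.ε | i + 1 => res.d i
              ε := f
              mem := fun | 0 => hG | i + 1 => res.mem i
              surjective := hf
              exact_zero := fun x ↦ ⟨fun hx ↦ ?_, ?_⟩
              exact_succ := fun
                | 0 => fun x ↦ (Subtype.ext_iff (a1 := res.ε x) (a2 := 0)).symm.trans
                    (res.exact_zero x)
                | i + 1 => res.exact_succ i }, ?_⟩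
    · obtain ⟨y, hy⟩ := res.surjective ⟨x, hx⟩
      exact ⟨y, congrArg Subtype.val hy⟩
    · rintro ⟨y, rfl⟩
      exact (res.ε y).2
    · intro i hi
      match i, hi with
      | i + 1, hi => exact hres i (by omega)

lemma restrictedGDim_congr {M : Type*} [AddCommGroup M] [Module R M] {M' : Type*}
    [AddCommGroup M'] [Module R M'] (e : M ≃ₗ[R] M') :
    restrictedGDim R M = restrictedGDim R M' :=
  le_antisymm (le_iInf fun res ↦ iInf_le_of_le (res.congr e.symm) le_rfl)
    (le_iInf fun res ↦ iInf_le_of_le (res.congr e) le_rfl)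

lemma restrictedGDim_le_iff {M : Type u} [AddCommGroup M] [Module R M] (n : ℕ) :
    restrictedGDim R M ≤ n ↔ HasGDimLE R n M := by
  constructor
  · intro h
    -- Passing to a strict bound produces an actual resolution from the infimum.
    have hlt : restrictedGDim R M < ((n + 1 : ℕ) : ℕ∞) :=
      h.trans_lt (by exact_mod_cast n.lt_succ_self)
    obtain ⟨res, hres⟩ := iInf_lt_iff.mp hlt
    refine res.hasGDimLE ((res.length_le_iff n).mp ?_)
    exact Order.le_of_lt_add_one (by exact_mod_cast hres)
  · intro h
    obtain ⟨res, hres⟩ := h.exists_resolution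
    exact iInf_le_of_le res ((res.length_le_iff n).mpr hres)

end Resolution

/-! ### The formula in ℕ∞ and the change of universe -/

lemma localDepth_add_restrictedGDim {R : Type u} [CommRing R] [IsLocalRing R] {M : Type u}
    [AddCommGroup M] [Module R M] [Nontrivial M] (hM : restrictedGDim R M < ⊤) :
    localDepth R M + restrictedGDim R M = localDepth R R := by
  obtain ⟨n, hn⟩ := ENat.ne_top_iff_exists.mp hM.ne
  have hle : HasGDimLE R n M := (restrictedGDim_le_iff n).mp hn.ge
  have hmin : ∀ j < n, ¬ HasGDimLE R j M := fun j hj h ↦ by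
    have := (restrictedGDim_le_iff j).mpr h
    rw [← hn, Nat.cast_le] at this
    omega
  have := hle.finite
  have key : ∀ k : ℕ, (k : ℕ∞) ≤ localDepth R M ↔ ((k + n : ℕ) : ℕ∞) ≤ localDepth R R := by
    intro k
    rw [natCast_le_localDepth_iff, natCast_le_localDepth_iff]
    exact depthGE_iff_of_hasGDimLE n hle hmin k
  rw [← hn]
  generalize localDepth R M = a at key
  generalize localDepth R R = b at key
  induction a using ENat.recTopCoe with
  | top =>
    rw [top_add, eq_comm, ENat.eq_top_iff_forall_ge]
    exact fun m ↦ (Nat.cast_le.mpr (Nat.le_add_right m n)).trans ((key m).mp le_top)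
  | coe a =>
    have h1 := (key a).mp le_rfl
    -- The case k = a bounds depth R from below by a + n; k = a + 1 bounds it from above.
    have h2 := (key (a + 1)).not.mp (by exact_mod_cast (by omega : ¬ a + 1 ≤ a))
    induction b using ENat.recTopCoe with
    | top => exact absurd le_top h2
    | coe b =>
      rw [Nat.cast_le] at h1 h2
      exact_mod_cast (by omega : a + n = b)

theorem theorem4p4 (R : Type u) [CommRing R] [IsLocalRing R] (M : Type v) [AddCommGroup M]
    [Module R M] [Nontrivial M] (hM : restrictedGDim R M < ⊤) :
    localDepth R M + restrictedGDim R M = localDepth R R := by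
  obtain ⟨res, -⟩ := iInf_lt_iff.mp hM
  -- M is replaced by a copy in the universe of R, where the Ext groups are available.
  let e : (res.G 0 ⧸ LinearMap.ker res.ε) ≃ₗ[R] M :=
    res.ε.quotKerEquivOfSurjective res.surjective
  have : Nontrivial (res.G 0 ⧸ LinearMap.ker res.ε) := e.toEquiv.nontrivial
  rw [← localDepth_congr e, ← restrictedGDim_congr e] at *
  exact localDepth_add_restrictedGDim hM
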